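/- Let $T>0$ and let $$\mathscr H=\{f\in C([0,1]) : f(0)=f(1)=0,\ f'(0)\text{ exists}\},\qquad \|f\|_{\mathscr H}=\sup_{x\in(0,1]}\left|\frac{f(x)}{x}\right| ,$$ where $f'(0)$ is the one-sided derivative. The space $C([0,T];\mathscr H)$ of $\mathscr H$-valued functions continuous on $[0,T]$ carries the norm $\|u\|_{\mathscr H,T}=\sup_{t\in[0,T]}\|u(t,\cdot)\|_{\mathscr H}$. Let $z\in C([0,T]\times[0,1])$ with $z(t,0)=z(t,1)=0$ for all $t\in[0,T]$ and $z(0,\cdot)\le 0$. A pair $(w,\eta)$ solves the parabolic obstacle problem with obstacle $z$ if 1. $w\in C([0,T]\times[0,1])$, $w(t,0)=w(t,1)=0$ for all $t\in[0,T]$, $w(0,\cdot)=0$ and $w\ge z$; 2. $\eta$ is a measure on $(0,1)\times[0,T]$; 3. $\partial_t w=\partial_{xx}w+\eta$ weakly: for every $\phi\in C^2([0,1])$ with $\phi(0)=\phi(1)=0$, the function $(x,s)\mapsto\phi(x)$ is $\eta$-integrable and, for every $t\in[0,T]$, $$\int_0^1 w(t,x)\phi(x)\,dx=\int_0^t\!\int_0^1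 w(s,x)\phi''(x)\,dx\,ds+\int_{(0,1)\times[0,t]}\phi(x)\,\eta(dx,ds);$$ 4. $\int_{(0,1)\times[0,t]}(w(s,x)-z(s,x))\,\eta(dx,ds)=0$ for every $t\in[0,T]$. **Theorem.** Let $z_1,z_2\in C([0,T];\mathscr H)$ and, for $i=1,2$, let $(w_i,\eta_i)$ solve the parabolic obstacle problem with obstacle $z_i$ (so that in particular $z_i(0,\cdot)\le0$). Then $w_1,w_2\in C([0,T];\mathscr H)$ and $$\|w_1-w_2\|_{\mathscr H,T}\le\|z_1-z_2\|_{\mathscr H,T}.$$ -/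

import Mathlib

open Set Filter Topology MeasureTheory

noncomputable section

/-- The linear space of all `f ∈ C([0,1])` with `f(0) = f(1) = 0` for which the (one-sided)
derivative `f'(0)` exists. (`IccExtend` extends `f` to the real line by constants; only its values
on `[0,1]` enter.) -/
def hSubmodule : Submodule ℝ C(Icc (0 : ℝ) 1, ℝ) where
  carrier := {f | f 0 = 0 ∧ f 1 = 0 ∧
    DifferentiableWithinAt ℝ (IccExtend (zero_le_one' ℝ) f) (Icc 0 1) 0}
  add_mem' := by
    rintro f g ⟨hf0, hf1, hf⟩ ⟨hg0, hg1, hg⟩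
    exact ⟨by simp [hf0, hg0], by simp [hf1, hg1], hf.add hg⟩
  zero_mem' := ⟨rfl, rfl, differentiableWithinAt_const (0 : ℝ)⟩
  smul_mem' := by
    rintro c f ⟨hf0, hf1, hf⟩
    exact ⟨by simp [hf0], by simp [hf1], hf.const_smul c⟩

/-- The space `𝓗`. It is kept apart from `hSubmodule` because it does not carry the supremum norm
of `C([0,1])`, but the norm `‖f‖ = sup_{x ∈ (0,1]} |f(x) / x|`. -/
def ScrH : Type := hSubmodule

namespace ScrH

instance : AddCommGroup ScrH := inferInstanceAs (AddCommGroup hSubmodule)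

instance : Module ℝ ScrH := inferInstanceAs (Module ℝ hSubmodule)

/-- The inclusion of `𝓗` in `C([0,1])`. -/
def toMap : ScrH →ₗ[ℝ] C(Icc (0 : ℝ) 1, ℝ) := hSubmodule.subtype

/-- Elements of `𝓗` are functions on `[0,1]`. -/
instance : CoeFun ScrH (fun _ => Icc (0 : ℝ) 1 → ℝ) := ⟨fun f => toMap f⟩

theorem toMap_mem (f : ScrH) : toMap f ∈ hSubmodule := Subtype.prop (p := (· ∈ hSubmodule)) f

theorem toMap_injective : Function.Injective toMap := Subtype.val_injective

/-- The inclusion of `(0,1]` in `[0,1]`. -/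
def incl (x : Ioc (0 : ℝ) 1) : Icc (0 : ℝ) 1 := ⟨x, Ioc_subset_Icc_self x.2⟩

/-- `‖f‖_𝓗 = sup_{x ∈ (0,1]} |f(x) / x|`. -/
instance : Norm ScrH := ⟨fun f => ⨆ x : Ioc (0 : ℝ) 1, |f (incl x) / (x : ℝ)|⟩

theorem norm_def (f : ScrH) : ‖f‖ = ⨆ x : Ioc (0 : ℝ) 1, |f (incl x) / (x : ℝ)| := rfl

theorem bddAbove (f : ScrH) :
    BddAbove (range fun x : Ioc (0 : ℝ) 1 => |f (incl x) / (x : ℝ)|) := by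
  obtain ⟨h0, -, hd⟩ := f.toMap_mem
  obtain ⟨C, hC⟩ := hd.hasFDerivWithinAt.isBigO_sub.bound
  rw [eventually_nhdsWithin_iff, Metric.eventually_nhds_iff] at hC
  obtain ⟨δ, hδ, hC⟩ := hC
  have hz : IccExtend (zero_le_one' ℝ) (toMap f) 0 = 0 := by
    rw [IccExtend_of_mem _ _ (left_mem_Icc.2 zero_le_one)]; exact h0
  refine ⟨max C (‖toMap f‖ / δ), ?_⟩
  rintro _ ⟨x, rfl⟩
  have hx0 : (0 : ℝ) < x := x.2.1
  have hx : (x : ℝ) ∈ Icc (0 : ℝ) 1 := Ioc_subset_Icc_self x.2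
  simp only [abs_div, abs_of_pos hx0]
  rcases lt_or_ge (x : ℝ) δ with h | h
  · refine le_max_of_le_left ((div_le_iff₀ hx0).2 ?_)
    have := hC (y := (x : ℝ)) (by simpa [abs_of_pos hx0] using h) hx
    rw [hz, IccExtend_of_mem _ _ hx] at this
    rw [sub_zero, sub_zero, Real.norm_eq_abs, Real.norm_eq_abs, abs_of_pos hx0] at this
    exact this
  · refine le_max_of_le_right (div_le_div₀ (norm_nonneg _) ?_ hδ h)
    exact (toMap f).norm_coe_le_norm (incl x)

theorem le_norm (f : ScrH) (x : Ioc (0 : ℝ) 1) : |f (incl x) / (x : ℝ)| ≤ ‖f‖ :=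
  le_ciSup f.bddAbove x

instance : Nonempty (Ioc (0 : ℝ) 1) := ⟨⟨1, by norm_num⟩⟩

theorem core : NormedSpace.Core ℝ ScrH where
  norm_nonneg f := Real.iSup_nonneg fun _ => abs_nonneg _
  norm_smul c f := by
    rw [norm_def, norm_def, Real.norm_eq_abs, Real.mul_iSup_of_nonneg (abs_nonneg c)]
    refine iSup_congr fun x => ?_
    rw [← abs_mul]
    exact congrArg _ (mul_div_assoc c _ _)
  norm_triangle f g := by
    refine ciSup_le fun x => ?_
    refine le_trans ?_ (add_le_add (f.le_norm x) (g.le_norm x))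
    refine le_trans (le_of_eq ?_) (abs_add_le _ _)
    exact congrArg _ (add_div _ _ _)
  norm_eq_zero_iff f := by
    constructor
    · intro h
      refine toMap_injective (ContinuousMap.ext fun x => ?_)
      rcases x.2.1.eq_or_lt with hx | hx
      · have : x = 0 := Subtype.ext hx.symm
        rw [this]; exact f.toMap_mem.1
      · have h1 := f.le_norm ⟨x, hx, x.2.2⟩
        rw [h] at h1
        have h2 := abs_eq_zero.1 (le_antisymm h1 (abs_nonneg _))
        exact (div_eq_zero_iff.1 h2).resolve_right hx.ne'
    · rintro rfl
      rw [norm_def]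
      simp

instance : NormedAddCommGroup ScrH := NormedAddCommGroup.ofCore core

instance : NormedSpace ℝ ScrH := NormedSpace.ofCore core

end ScrH

/-- Lebesgue measure on the interval `[a,b]`. -/
def lebIcc (a b : ℝ) : Measure (Icc a b) := Measure.comap Subtype.val volume

/-- `(w, η)` satisfies the heat equation on `[0,T] × [0,1]` with obstacle `z`, zero Dirichlet
boundary values and zero initial value. Functions of time and space are written `w t x`;
the measure `η` lives on the product `(0,1) × [0,T]` of space and time. -/
structure SolvesObstacleProblem (T : ℝ) (z w : Icc (0 : ℝ) T → Icc (0 : ℝ) 1 → ℝ)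
    (η : Measure (Ioo (0 : ℝ) 1 × Icc (0 : ℝ) T)) : Prop where
  /-- the obstacle is continuous on `[0,T] × [0,1]` -/
  obstacle_continuous : Continuous (Function.uncurry z)
  obstacle_boundary : ∀ t, z t 0 = 0 ∧ z t 1 = 0
  obstacle_initial : ∀ t : Icc (0 : ℝ) T, (t : ℝ) = 0 → ∀ x, z t x ≤ 0
  continuous : Continuous (Function.uncurry w)
  boundary : ∀ t, w t 0 = 0 ∧ w t 1 = 0
  initial : ∀ t : Icc (0 : ℝ) T, (t : ℝ) = 0 → ∀ x, w t x = 0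
  above_obstacle : ∀ t x, z t x ≤ w t x
  /-- the integral of a test function against `η` makes sense -/
  integrable : ∀ φ : ℝ → ℝ, ContDiff ℝ 2 φ → φ 0 = 0 → φ 1 = 0 →
    Integrable (fun p : Ioo (0 : ℝ) 1 × Icc (0 : ℝ) T => φ p.1) η
  /-- `∂w/∂t = ∂²w/∂x² + η` weakly, the test functions being `φ ∈ C²([0,1])`, `φ(0) = φ(1) = 0` -/
  weak_equation : ∀ φ : ℝ → ℝ, ContDiff ℝ 2 φ → φ 0 = 0 → φ 1 = 0 → ∀ t : Icc (0 : ℝ) T,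
    (∫ x, w t x * φ x ∂lebIcc 0 1) =
      (∫ s in {s | s ≤ t}, ∫ x, w s x * deriv (deriv φ) x ∂lebIcc 0 1 ∂lebIcc 0 T) +
      ∫ p in {p : Ioo (0 : ℝ) 1 × Icc (0 : ℝ) T | p.2 ≤ t}, φ p.1 ∂η
  /-- `∫₀ᵗ ∫₀¹ (w - z) dη = 0`; the integrand is nonnegative, and the integral is the
  `[0,∞]`-valued one -/
  complementarity : ∀ t : Icc (0 : ℝ) T,
    ∫⁻ p in {p : Ioo (0 : ℝ) 1 × Icc (0 : ℝ) T | p.2 ≤ t},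
      ENNReal.ofReal (w p.2 ⟨p.1, Ioo_subset_Icc_self p.1.2⟩ -
        z p.2 ⟨p.1, Ioo_subset_Icc_self p.1.2⟩) ∂η = 0

end

/-!
The proof rests on one maximum principle. If `w₁`, `w₂` are weak solutions with measures `η₁`, `η₂`,
`ψ` is a classical supersolution of the heat equation on `[t₁,t₂] × [0,b]` with `w₁ - w₂ ≤ ψ` on the
parabolic boundary, and `η₁` does not charge `{w₁ - w₂ > ψ}`, then `w₁ - w₂ ≤ ψ`
(`WeakHeat.max_principle`). It suffices to mollify `w₁ - w₂` in space: testing the equation with a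
translated bump shows that the mollification is `C²` in space and bounds its increments in time by
the time integral of its second space derivative, as long as `{w₁ - w₂ > ψ}` contains the support.
A positive maximum of the mollification minus `ψ + c (t - t₁)` then contradicts the
second-derivative test.

*The estimate.* Where `w₁ > w₂ + c x`, with `c = ‖z₁ - z₂‖`, one has `w₁ > z₂ + c x ≥ z₁`, so `η₁`
vanishes there by complementarity. As `c x` is caloric, `w₁ ≤ w₂ + c x`
(`SolvesObstacleProblem.le_add_of_obstacle_le`). Comparison with the zero solution gives
`|w| ≤ C x`.

*Membership in `C([0,T]; 𝓗)`.* It is enough to find, for each `t₀` and `ε > 0`, a slope `L` with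
`|w(t,x) - L x| ≤ ε x` near `(t₀, 0)` (`SolvesObstacleProblem.exists_slope`). Near this point the
obstacle is within `ε x` of a linear function `a x`. A supersolution which exceeds `w + 2 ε x` on the
parabolic boundary of a small rectangle exceeds the caloric function `(a + ε) x` there, hence in
the interior, so it stays above the obstacle and `w` lies below it; a subsolution below `w` on the
boundary stays below `w` unconditionally. Both are taken of the form `p ± (error)`, where `p` is a
finite sum of `exp(-κ² s) sin(κ x)`, for which `p / x` is continuous, and whose initial value
approximates `w` (`OddCaloric.exists_approx`). The error made for `x ≤ r` and for `x` away from `0`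
is absorbed by a Gaussian supersolution concentrated near `0` and by the cubic heat polynomial; both
have small slope at `0` around time `t₀`.
-/

noncomputable section

/-! ### Weak solutions and mollification in space -/

/-- The function `w`, defined on all of `ℝ × ℝ`, is a weak solution of `∂w/∂t = ∂²w/∂x² + η` on
`[0,T] × (0,1)`, started from `0` (plus the mass of `η` at time `0`). The test functions are
`φ ∈ C²` with `φ(0) = φ(1) = 0`, which encodes zero boundary values. -/
structure WeakHeat (T : ℝ) (w : ℝ → ℝ → ℝ) (η : Measure (Ioo (0 : ℝ) 1 × Icc (0 : ℝ) T)) :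
    Prop where
  continuous : Continuous (Function.uncurry w)
  integrable : ∀ φ : ℝ → ℝ, ContDiff ℝ 2 φ → φ 0 = 0 → φ 1 = 0 →
    Integrable (fun p : Ioo (0 : ℝ) 1 × Icc (0 : ℝ) T => φ p.1) η
  weak_equation : ∀ φ : ℝ → ℝ, ContDiff ℝ 2 φ → φ 0 = 0 → φ 1 = 0 → ∀ t ∈ Icc 0 T,
    (∫ x in (0 : ℝ)..1, w t x * φ x) =
      (∫ s in (0 : ℝ)..t, ∫ x in (0 : ℝ)..1, w s x * deriv (deriv φ) x) +
      ∫ p in {p : Ioo (0 : ℝ) 1 × Icc (0 : ℝ) T | (p.2 : ℝ) ≤ t}, φ p.1 ∂η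

theorem WeakHeat.zero (T : ℝ) : WeakHeat T (fun _ _ => 0) 0 where
  continuous := by unfold Function.uncurry; fun_prop
  integrable := by simp
  weak_equation := by simp

theorem continuous_deriv_deriv {φ : ℝ → ℝ} (hφ : ContDiff ℝ 2 φ) :
    Continuous (deriv (deriv φ)) := by
  have := hφ.continuous_iteratedDeriv 2 le_rfl
  rwa [iteratedDeriv_succ, iteratedDeriv_one] at this

theorem measurableSet_time_slab (T s t : ℝ) :
    MeasurableSet {p : Ioo (0 : ℝ) 1 × Icc (0 : ℝ) T | s < p.2 ∧ (p.2 : ℝ) ≤ t} :=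
  (measurable_subtype_coe.comp measurable_snd) measurableSet_Ioc

namespace WeakHeat

variable {T : ℝ} {w w₁ w₂ : ℝ → ℝ → ℝ} {η η₁ η₂ : Measure (Ioo (0 : ℝ) 1 × Icc (0 : ℝ) T)}

theorem increment (h : WeakHeat T w η) {φ : ℝ → ℝ} (hφ : ContDiff ℝ 2 φ) (h0 : φ 0 = 0)
    (h1 : φ 1 = 0) {s t : ℝ} (hs : 0 ≤ s) (hst : s ≤ t) (ht : t ≤ T) :
    (∫ x in (0 : ℝ)..1, w t x * φ x) - (∫ x in (0 : ℝ)..1, w s x * φ x) =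
      (∫ r in s..t, ∫ x in (0 : ℝ)..1, w r x * deriv (deriv φ) x) +
      ∫ p in {p : Ioo (0 : ℝ) 1 × Icc (0 : ℝ) T | s < p.2 ∧ (p.2 : ℝ) ≤ t}, φ p.1 ∂η := by
  have hc : Continuous fun r => ∫ x in (0 : ℝ)..1, w r x * deriv (deriv φ) x := by
    refine intervalIntegral.continuous_parametric_intervalIntegral_of_continuous' ?_ 0 1
    exact h.continuous.mul ((continuous_deriv_deriv hφ).comp continuous_snd)
  rw [h.weak_equation φ hφ h0 h1 t ⟨hs.trans hst, ht⟩,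
    h.weak_equation φ hφ h0 h1 s ⟨hs, hst.trans ht⟩,
    ← intervalIntegral.integral_add_adjacent_intervals (hc.intervalIntegrable 0 s)
      (hc.intervalIntegrable s t)]
  have hu : {p : Ioo (0 : ℝ) 1 × Icc (0 : ℝ) T | (p.2 : ℝ) ≤ t} =
      {p | (p.2 : ℝ) ≤ s} ∪ {p | s < p.2 ∧ (p.2 : ℝ) ≤ t} := by
    ext p
    simp only [mem_ofPred_eq, mem_union]
    constructor
    · intro hp
      rcases le_or_gt (p.2 : ℝ) s with h | h
      · exact Or.inl h
      · exact Or.inr ⟨h, hp⟩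
    · rintro (h | h)
      · exact h.trans hst
      · exact h.2
  have hm := measurableSet_time_slab T s t
  rw [hu, setIntegral_union _ hm (h.integrable φ hφ h0 h1).integrableOn
    (h.integrable φ hφ h0 h1).integrableOn]
  · ring
  · rw [Set.disjoint_left]
    intro p hp hp'
    exact absurd hp'.1 (not_lt.2 hp)

/-- Where `η₁` does not charge the support of a nonnegative test function, the difference of two
weak solutions is a weak subsolution of the heat equation. -/
theorem sub_increment_le (h₁ : WeakHeat T w₁ η₁) (h₂ : WeakHeat T w₂ η₂) {φ : ℝ → ℝ}
    (hφ : ContDiff ℝ 2 φ) (h0 : φ 0 = 0) (h1 : φ 1 = 0) (hpos : ∀ x, 0 ≤ φ x) {s t : ℝ}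
    (hs : 0 ≤ s) (hst : s ≤ t) (ht : t ≤ T)
    (hη : η₁ {p | (s < p.2 ∧ (p.2 : ℝ) ≤ t) ∧ φ p.1 ≠ 0} = 0) :
    (∫ x in (0 : ℝ)..1, (w₁ t x - w₂ t x) * φ x) - (∫ x in (0 : ℝ)..1, (w₁ s x - w₂ s x) * φ x) ≤
      ∫ r in s..t, ∫ x in (0 : ℝ)..1, (w₁ r x - w₂ r x) * deriv (deriv φ) x := by
  have key : ∀ {w η} (_ : WeakHeat T w η) {g : ℝ → ℝ} (_ : Continuous g),
      Continuous fun r => ∫ x in (0 : ℝ)..1, w r x * g x := fun h g hg => by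
    refine intervalIntegral.continuous_parametric_intervalIntegral_of_continuous' ?_ 0 1
    exact h.continuous.mul (hg.comp continuous_snd)
  have hsplit : ∀ {g : ℝ → ℝ} (_ : Continuous g) (r : ℝ),
      (∫ x in (0 : ℝ)..1, (w₁ r x - w₂ r x) * g x) =
        (∫ x in (0 : ℝ)..1, w₁ r x * g x) - ∫ x in (0 : ℝ)..1, w₂ r x * g x := by
    intro g hg r
    rw [← intervalIntegral.integral_sub]
    · simp only [sub_mul]
    · exact ((h₁.continuous.uncurry_left r).mul hg).intervalIntegrable _ _
    · exact ((h₂.continuous.uncurry_left r).mul hg).intervalIntegrable _ _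
  have hd := continuous_deriv_deriv hφ
  simp only [hsplit hφ.continuous, hsplit hd]
  rw [intervalIntegral.integral_sub ((key h₁ hd).intervalIntegrable _ _)
    ((key h₂ hd).intervalIntegrable _ _)]
  have e₁ := h₁.increment hφ h0 h1 hs hst ht
  have e₂ := h₂.increment hφ h0 h1 hs hst ht
  have hm := measurableSet_time_slab T s t
  have z₁ : ∫ p in {p : Ioo (0 : ℝ) 1 × Icc (0 : ℝ) T | s < p.2 ∧ (p.2 : ℝ) ≤ t}, φ p.1 ∂η₁ = 0 := by
    refine integral_eq_zero_of_ae ?_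
    refine (ae_restrict_iff' hm).2 ?_
    rw [ae_iff]
    convert hη using 2
    ext p
    simp [and_assoc]
  have z₂ : 0 ≤ ∫ p in {p : Ioo (0 : ℝ) 1 × Icc (0 : ℝ) T | s < p.2 ∧ (p.2 : ℝ) ≤ t}, φ p.1 ∂η₂ :=
    integral_nonneg fun p => hpos _
  linarith

end WeakHeat

theorem second_deriv_nonpos_of_isLocalMax {f f' : ℝ → ℝ} {f'' x₀ : ℝ} (hmax : IsLocalMax f x₀)
    (hf : ∀ᶠ x in 𝓝 x₀, HasDerivAt f (f' x) x) (hf' : HasDerivAt f' f'' x₀) : f'' ≤ 0 := by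
  by_contra! hpos
  have e1 : deriv f =ᶠ[𝓝 x₀] f' := hf.mono fun x hx => hx.deriv
  have e2 : deriv (deriv f) x₀ = f'' := by rw [e1.deriv_eq, hf'.deriv]
  have hmin : IsLocalMin f x₀ := isLocalMin_of_deriv_deriv_pos (by rw [e2]; exact hpos)
    hmax.deriv_eq_zero hf.self_of_nhds.continuousAt
  have hconst : f =ᶠ[𝓝 x₀] fun _ => f x₀ := by
    filter_upwards [hmax, hmin] with x h1 h2 using le_antisymm h1 h2
  have e3 : deriv (deriv f) x₀ = 0 := by
    rw [hconst.deriv.deriv_eq]; simp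
  linarith

theorem deriv_nonpos_of_eventually_nonneg_left {G : ℝ → ℝ} {d t : ℝ} (hG : HasDerivAt G d t)
    (h0 : G t = 0) (hpos : ∀ᶠ s in 𝓝[<] t, 0 ≤ G s) : d ≤ 0 := by
  have h := (hasDerivWithinAt_iff_tendsto_slope' (s := Iio t) (by simp)).1 hG.hasDerivWithinAt
  refine le_of_tendsto h ?_
  filter_upwards [hpos, self_mem_nhdsWithin] with s hs hst
  rw [slope_def_field, h0, sub_zero]
  exact div_nonpos_of_nonneg_of_nonpos hs (sub_nonpos.2 (le_of_lt hst))

/-- The convolution in the space variable of `u(t,·)`, restricted to `[0,1]`, with `f`. -/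
def spaceConv (f : ℝ → ℝ) (u : ℝ → ℝ → ℝ) (t y : ℝ) : ℝ := ∫ x in (0 : ℝ)..1, u t x * f (y - x)

theorem continuous_spaceConv {f : ℝ → ℝ} (hf : Continuous f) {u : ℝ → ℝ → ℝ}
    (hu : Continuous (Function.uncurry u)) : Continuous (Function.uncurry (spaceConv f u)) := by
  have : Continuous (Function.uncurry fun (p : ℝ × ℝ) (x : ℝ) => u p.1 x * f (p.2 - x)) := by
    have h1 : Continuous fun q : (ℝ × ℝ) × ℝ => u q.1.1 q.2 :=
      hu.comp ((continuous_fst.comp continuous_fst).prodMk continuous_snd)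
    exact h1.mul (hf.comp (by fun_prop))
  exact intervalIntegral.continuous_parametric_intervalIntegral_of_continuous' this 0 1

/-- Away from the ends of `[0,1]`, `spaceConv` is a convolution on the real line. -/
theorem spaceConv_eq_convolution {f : ℝ → ℝ} {ε : ℝ} (hf : ∀ x, ε ≤ |x| → f x = 0)
    (u : ℝ → ℝ → ℝ) (t : ℝ) {y : ℝ} (hy : y ∈ Icc ε (1 - ε)) :
    spaceConv f u t y = convolution f (u t) (ContinuousLinearMap.lsmul ℝ ℝ) volume y := by
  rw [convolution_eq_swap, spaceConv, intervalIntegral.integral_of_le zero_le_one,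
    setIntegral_eq_integral_of_forall_compl_eq_zero]
  · simp [mul_comm]
  · intro x hx
    rw [hf, mul_zero]
    rw [mem_Ioc, not_and_or, not_lt, not_le] at hx
    rcases hx with hx | hx
    · exact le_trans (by linarith [hy.1]) (le_abs_self _)
    · exact le_trans (by linarith [hy.2]) (neg_le_abs _)

theorem hasDerivAt_spaceConv {f : ℝ → ℝ} (hfc : ContDiff ℝ 1 f) {ε : ℝ}
    (hf : ∀ x, ε ≤ |x| → f x = 0) (hf' : ∀ x, ε ≤ |x| → deriv f x = 0) {u : ℝ → ℝ → ℝ}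
    (hu : Continuous (Function.uncurry u)) (t : ℝ) {y : ℝ} (hy : y ∈ Ioo ε (1 - ε)) :
    HasDerivAt (spaceConv f u t) (spaceConv (deriv f) u t y) y := by
  have hs : HasCompactSupport f := by
    refine HasCompactSupport.of_support_subset_isCompact (isCompact_Icc (a := -ε) (b := ε)) ?_
    intro x hx
    by_contra hx'
    exact hx (hf x (by rw [mem_Icc, ← abs_le] at hx'; exact (not_le.1 hx').le))
  have h := hs.hasDerivAt_convolution_left (ContinuousLinearMap.lsmul ℝ ℝ) (μ := volume) hfc
    (hu.uncurry_left t).locallyIntegrable y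
  rw [spaceConv_eq_convolution hf' u t (Ioo_subset_Icc_self hy)]
  refine h.congr_of_eventuallyEq ?_
  filter_upwards [Ioo_mem_nhds hy.1 hy.2] with z hz
  exact spaceConv_eq_convolution hf u t (Ioo_subset_Icc_self hz)

/-! ### The maximum principle -/

/-- `ψ` is a classical supersolution of the heat equation on `(t₁,t₂] × (0,b)`, continuous up to
the boundary. -/
structure IsHeatSuper (t₁ t₂ b : ℝ) (ψ : ℝ → ℝ → ℝ) : Prop where
  continuousOn : ContinuousOn (Function.uncurry ψ) (Icc t₁ t₂ ×ˢ Icc 0 b)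
  exists_deriv : ∃ ψx ψxx ψt : ℝ → ℝ → ℝ, ∀ t ∈ Ioc t₁ t₂, ∀ x ∈ Ioo 0 b,
    HasDerivAt (ψ t) (ψx t x) x ∧ HasDerivAt (ψx t) (ψxx t x) x ∧
      HasDerivAt (fun s => ψ s x) (ψt t x) t ∧ ψxx t x ≤ ψt t x

namespace IsHeatSuper

variable {t₁ t₂ b : ℝ} {ψ χ : ℝ → ℝ → ℝ}

theorem add (hψ : IsHeatSuper t₁ t₂ b ψ) (hχ : IsHeatSuper t₁ t₂ b χ) :
    IsHeatSuper t₁ t₂ b (fun t x => ψ t x + χ t x) := by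
  obtain ⟨hc, ψx, ψxx, ψt, hd⟩ := hψ
  obtain ⟨hc', χx, χxx, χt, hd'⟩ := hχ
  refine ⟨hc.add hc', fun t x => ψx t x + χx t x, fun t x => ψxx t x + χxx t x,
    fun t x => ψt t x + χt t x, fun t ht x hx => ?_⟩
  obtain ⟨h1, h2, h3, h4⟩ := hd t ht x hx
  obtain ⟨k1, k2, k3, k4⟩ := hd' t ht x hx
  exact ⟨h1.add k1, h2.add k2, h3.add k3, add_le_add h4 k4⟩

theorem const_mul (hψ : IsHeatSuper t₁ t₂ b ψ) {c : ℝ} (hc : 0 ≤ c) :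
    IsHeatSuper t₁ t₂ b (fun t x => c * ψ t x) := by
  obtain ⟨hψc, ψx, ψxx, ψt, hd⟩ := hψ
  refine ⟨hψc.const_mul c, fun t x => c * ψx t x, fun t x => c * ψxx t x,
    fun t x => c * ψt t x, fun t ht x hx => ?_⟩
  obtain ⟨h1, h2, h3, h4⟩ := hd t ht x hx
  exact ⟨h1.const_mul c, h2.const_mul c, h3.const_mul c, mul_le_mul_of_nonneg_left h4 hc⟩

theorem linear (t₁ t₂ b c : ℝ) : IsHeatSuper t₁ t₂ b (fun _ x => c * x) := by
  refine ⟨?_, fun _ _ => c, fun _ _ => 0, fun _ _ => 0, fun t _ x _ => ⟨?_, ?_, ?_, le_rfl⟩⟩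
  · unfold Function.uncurry; fun_prop
  · simpa using (hasDerivAt_id x).const_mul c
  · exact hasDerivAt_const _ _
  · exact hasDerivAt_const _ _

end IsHeatSuper

/-- The weak maximum principle for the difference of two weak solutions on `[t₁,t₂] × [0,b]`.
Nothing is required of `η₂`, which only pushes `w₁ - w₂` down. -/
theorem WeakHeat.max_principle {T : ℝ} {w₁ w₂ : ℝ → ℝ → ℝ}
    {η₁ η₂ : Measure (Ioo (0 : ℝ) 1 × Icc (0 : ℝ) T)} (h₁ : WeakHeat T w₁ η₁)
    (h₂ : WeakHeat T w₂ η₂) {t₁ t₂ b : ℝ} (ht₁ : 0 ≤ t₁) (ht₂ : t₂ ≤ T) (hb1 : b ≤ 1)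
    {ψ : ℝ → ℝ → ℝ} (hsuper : IsHeatSuper t₁ t₂ b ψ)
    (hinit : ∀ x ∈ Icc 0 b, w₁ t₁ x - w₂ t₁ x ≤ ψ t₁ x)
    (hleft : ∀ t ∈ Icc t₁ t₂, w₁ t 0 - w₂ t 0 ≤ ψ t 0)
    (hright : ∀ t ∈ Icc t₁ t₂, w₁ t b - w₂ t b ≤ ψ t b)
    (hη : η₁ {p | (p.2 : ℝ) ∈ Icc t₁ t₂ ∧ (p.1 : ℝ) ≤ b ∧
      ψ p.2 p.1 < w₁ p.2 p.1 - w₂ p.2 p.1} = 0) :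
    ∀ t ∈ Icc t₁ t₂, ∀ x ∈ Icc 0 b, w₁ t x - w₂ t x ≤ ψ t x := by
  intro t₀ ht₀ x₀ hx₀
  by_contra! hlt
  obtain ⟨hψ, ψx, ψxx, ψt, hder⟩ := hsuper
  set u : ℝ → ℝ → ℝ := fun t x => w₁ t x - w₂ t x with hu_def
  have huc : Continuous (Function.uncurry u) := h₁.continuous.sub h₂.continuous
  -- Subtracting `c (t - t₁)` turns `ψ` into a strict supersolution and keeps a positive maximum.
  obtain ⟨c, hc, M, hM, hcM⟩ : ∃ c > 0, ∃ M > 0, M + c * (t₀ - t₁) ≤ u t₀ x₀ - ψ t₀ x₀ := by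
    have h1 : 0 < u t₀ x₀ - ψ t₀ x₀ := sub_pos.2 hlt
    have h2 : 0 < t₀ - t₁ + 1 := by linarith [ht₀.1]
    refine ⟨(u t₀ x₀ - ψ t₀ x₀) / (2 * (t₀ - t₁ + 1)), by positivity, (u t₀ x₀ - ψ t₀ x₀) / 2,
      by positivity, ?_⟩
    rw [div_mul_eq_mul_div, ← le_sub_iff_add_le', div_le_iff₀ (by positivity)]
    nlinarith
  set v : ℝ → ℝ → ℝ := fun t x => u t x - ψ t x - c * (t - t₁) with hv_def
  have hvc : ContinuousOn (Function.uncurry v) (Icc t₁ t₂ ×ˢ Icc 0 b) := by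
    refine (huc.continuousOn.sub hψ).sub ?_
    fun_prop
  have hQ : IsCompact (Icc t₁ t₂ ×ˢ Icc 0 b) := isCompact_Icc.prod isCompact_Icc
  obtain ⟨δ₁, hδ₁, hv⟩ := Metric.uniformContinuousOn_iff.1
    (hQ.uniformContinuousOn_of_continuous hvc) (M / 4) (by positivity)
  obtain ⟨δ₂, hδ₂, hu⟩ := Metric.uniformContinuousOn_iff.1
    (hQ.uniformContinuousOn_of_continuous huc.continuousOn) (M / 4) (by positivity)
  have hv' : ∀ t ∈ Icc t₁ t₂, ∀ x ∈ Icc 0 b, ∀ t' ∈ Icc t₁ t₂, ∀ x' ∈ Icc 0 b,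
      |t - t'| < δ₁ → |x - x'| < δ₁ → |v t x - v t' x'| < M / 4 := by
    intro t ht x hx t' ht' x' hx' h1 h2
    exact hv (t, x) ⟨ht, hx⟩ (t', x') ⟨ht', hx'⟩ (max_lt h1 h2)
  have hc0 : ∀ t ∈ Icc t₁ t₂, 0 ≤ c * (t - t₁) := fun t ht =>
    mul_nonneg hc.le (sub_nonneg.2 ht.1)
  -- Points with a large value of `v` keep a distance `δ₁` from the parabolic boundary.
  have hfar : ∀ t ∈ Icc t₁ t₂, ∀ x ∈ Icc 0 b, M / 4 ≤ v t x →
      t₁ + δ₁ ≤ t ∧ δ₁ ≤ x ∧ x ≤ b - δ₁ := by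
    intro t ht x hx hval
    have hb : (0 : ℝ) ≤ b := hx.1.trans hx.2
    refine ⟨?_, ?_, ?_⟩
    · by_contra! hcon
      have h1 := hv' t ht x hx t₁ ⟨le_rfl, ht.1.trans ht.2⟩ x hx
        (by rw [abs_lt]; constructor <;> linarith [ht.1]) (by simpa using hδ₁)
      have h2 : v t₁ x ≤ 0 := by
        have := hinit x hx
        simp only [hv_def, hu_def]; linarith
      linarith [(abs_lt.1 h1).2]
    · by_contra! hcon
      have h1 := hv' t ht x hx t ht 0 ⟨le_rfl, hb⟩
        (by simpa using hδ₁) (by rw [abs_lt]; constructor <;> linarith [hx.1])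
      have h2 : v t 0 ≤ 0 := by
        have := hleft t ht
        have := hc0 t ht
        simp only [hv_def, hu_def]; linarith
      linarith [(abs_lt.1 h1).2]
    · by_contra! hcon
      have h1 := hv' t ht x hx t ht b ⟨hb, le_rfl⟩
        (by simpa using hδ₁) (by rw [abs_lt]; constructor <;> linarith [hx.2])
      have h2 : v t b ≤ 0 := by
        have := hright t ht
        have := hc0 t ht
        simp only [hv_def, hu_def]; linarith
      linarith [(abs_lt.1 h1).2]
  obtain ⟨ε, hε, hεδ₁, hεδ₂⟩ : ∃ ε > 0, ε < δ₁ ∧ ε < δ₂ :=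
    ⟨min δ₁ δ₂ / 2, by positivity, by
      have := min_le_left δ₁ δ₂; linarith, by have := min_le_right δ₁ δ₂; linarith⟩
  let ρ : ContDiffBump (0 : ℝ) := ⟨ε / 4, ε / 2, by positivity, by linarith⟩
  set f : ℝ → ℝ := ρ.normed volume with hf_def
  have hfs : ContDiff ℝ 2 f := ρ.contDiff_normed (n := 2)
  have hfs' : ContDiff ℝ 1 (deriv f) := ContDiff.deriv' (n := 1) hfs
  have hvan : ∀ g : ℝ → ℝ, tsupport g ⊆ tsupport f → ∀ x, ε ≤ |x| → g x = 0 := by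
    intro g hg x hx
    by_contra hne
    have h3 : x ∈ tsupport f := hg (subset_tsupport g hne)
    rw [hf_def, ρ.tsupport_normed_eq, mem_closedBall_zero_iff, Real.norm_eq_abs] at h3
    have h4 : |x| ≤ ε / 2 := h3
    linarith
  have hf0 := hvan f subset_rfl
  have hf1 := hvan (deriv f) (tsupport_deriv_subset)
  have hf2 := hvan (deriv (deriv f)) (tsupport_deriv_subset.trans tsupport_deriv_subset)
  set U := spaceConv f u with hU_def
  set U₂ := spaceConv (deriv (deriv f)) u with hU₂_def
  have hUc : Continuous (Function.uncurry U) := continuous_spaceConv hfs.continuous huc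
  have hU₂c : Continuous (Function.uncurry U₂) :=
    continuous_spaceConv (continuous_deriv_deriv hfs) huc
  have hclose : ∀ t ∈ Icc t₁ t₂, ∀ y ∈ Icc ε (b - ε), |U t y - u t y| ≤ M / 4 := by
    intro t ht y hy
    rw [hU_def, spaceConv_eq_convolution hf0 u t ⟨hy.1, by linarith [hy.2]⟩]
    refine ρ.dist_normed_convolution_le (huc.uncurry_left t).aestronglyMeasurable ?_
    intro x hx
    have hx' : |x - y| < ε / 2 := hx
    have hx'' := abs_lt.1 hx'
    refine (hu (t, x) ⟨ht, ?_, ?_⟩ (t, y) ⟨ht, ?_, ?_⟩ (max_lt ?_ ?_)).le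
    · change 0 ≤ x; linarith [hy.1]
    · change x ≤ b; linarith [hy.2]
    · change 0 ≤ y; linarith [hy.1]
    · change y ≤ b; linarith [hy.2]
    · simpa using hδ₂
    · change |x - y| < δ₂; linarith
  have hM₀ : M ≤ v t₀ x₀ := by simp only [hv_def]; linarith
  obtain ⟨-, hx₀l, hx₀r⟩ := hfar t₀ ht₀ x₀ hx₀ (by linarith)
  -- A maximum point `(τ, y)` of the mollified function.
  have hsub : Icc ε (b - ε) ⊆ Icc 0 b := Icc_subset_Icc hε.le (by linarith)
  have hΦc : ContinuousOn (fun p : ℝ × ℝ => U p.1 p.2 - ψ p.1 p.2 - c * (p.1 - t₁))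
      (Icc t₁ t₂ ×ˢ Icc ε (b - ε)) := by
    refine (hUc.continuousOn.sub (hψ.mono (prod_mono subset_rfl hsub))).sub ?_
    fun_prop
  obtain ⟨⟨τ, y⟩, ⟨hτ, hy⟩, hmax⟩ := (isCompact_Icc.prod isCompact_Icc).exists_isMaxOn
    ⟨(t₀, x₀), ht₀, ⟨by linarith, by linarith⟩⟩ hΦc
  have hmax' : ∀ t ∈ Icc t₁ t₂, ∀ x ∈ Icc ε (b - ε),
      U t x - ψ t x - c * (t - t₁) ≤ U τ y - ψ τ y - c * (τ - t₁) := fun t ht x hx =>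
    hmax (show (t, x) ∈ _ from ⟨ht, hx⟩)
  replace hτ : τ ∈ Icc t₁ t₂ := hτ
  replace hy : y ∈ Icc ε (b - ε) := hy
  have hvy : M / 2 ≤ v τ y := by
    have e1 := hmax' t₀ ht₀ x₀ ⟨by linarith, by linarith⟩
    have e2 := (abs_le.1 (hclose t₀ ht₀ x₀ ⟨by linarith, by linarith⟩)).1
    have e3 := (abs_le.1 (hclose τ hτ y hy)).2
    simp only [hv_def] at hM₀ ⊢
    linarith
  obtain ⟨hτl, hyl, hyr⟩ := hfar τ hτ y (hsub hy) (by linarith)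
  have hτ' : τ ∈ Ioc t₁ t₂ := ⟨by linarith, hτ.2⟩
  have hy' : y ∈ Ioo 0 b := ⟨by linarith, by linarith⟩
  have hyI : y ∈ Ioo ε (1 - ε) := ⟨by linarith, by linarith⟩
  -- The second derivative in space at the maximum point is nonpositive.
  have hspace : U₂ τ y - ψxx τ y ≤ 0 := by
    refine second_deriv_nonpos_of_isLocalMax (f := fun x => U τ x - ψ τ x)
      (f' := fun x => spaceConv (deriv f) u τ x - ψx τ x) (x₀ := y) ?_ ?_ ?_
    · filter_upwards [Ioo_mem_nhds (show ε < y by linarith) (show y < b - ε by linarith)] with x hx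
      have := hmax' τ hτ x (Ioo_subset_Icc_self hx)
      linarith
    · filter_upwards [Ioo_mem_nhds hyI.1 hyI.2, Ioo_mem_nhds hy'.1 hy'.2] with x hxI hx'
      exact (hasDerivAt_spaceConv (hfs.of_le one_le_two) hf0 hf1 huc τ hxI).sub (hder τ hτ' x hx').1
    · exact (hasDerivAt_spaceConv hfs' hf1 hf2 huc τ hyI).sub (hder τ hτ' y hy').2.1
  -- The mollified weak inequality bounds the time increments at `y`.
  have hinc : ∀ s, τ - δ₁ < s → s < τ → U τ y - U s y ≤ ∫ r in s..τ, U₂ r y := by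
    intro s hs hsτ
    have hd1 : deriv (fun x => f (y - x)) = fun x => -deriv f (y - x) := by
      ext x; exact deriv_comp_const_sub f y x
    have hd2 : deriv (deriv fun x => f (y - x)) = fun x => deriv (deriv f) (y - x) := by
      rw [hd1]
      ext x
      rw [deriv.fun_neg, deriv_comp_const_sub, neg_neg]
    have := h₁.sub_increment_le h₂ (φ := fun x => f (y - x)) (s := s) (t := τ)
      (hfs.comp (contDiff_const.sub contDiff_id))
      (hf0 _ (by rw [sub_zero]; exact (le_of_lt hyI.1).trans (le_abs_self _)))
      (hf0 _ (le_trans (by linarith [hyI.2]) (neg_le_abs _)))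
      (fun x => ρ.nonneg_normed _) (by linarith) hsτ.le (hτ.2.trans ht₂) ?_
    · simp only [hd2] at this
      exact this
    · refine measure_mono_null ?_ hη
      rintro p ⟨⟨hp1, hp2⟩, hp3⟩
      have hpy : |y - p.1| < ε := by
        by_contra! hcon
        exact hp3 (hf0 _ hcon)
      have hpy' := abs_lt.1 hpy
      have hpt : (p.2 : ℝ) ∈ Icc t₁ t₂ := ⟨by linarith, hp2.trans hτ.2⟩
      have hpb : (p.1 : ℝ) ≤ b := by linarith
      refine ⟨hpt, hpb, ?_⟩
      have h3 := (abs_lt.1 (hv' p.2 hpt p.1 ⟨p.1.2.1.le, hpb⟩ τ hτ y (hsub hy)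
        (by rw [abs_lt]; constructor <;> linarith) (by rw [abs_sub_comm]; linarith))).1
      have h4 := hc0 p.2 hpt
      have h5 : 0 < v p.2 p.1 := by linarith
      simp only [hv_def, hu_def] at h5
      linarith
  have htime : ψt τ y + c - U₂ τ y ≤ 0 := by
    have hU₂y : Continuous fun r => U₂ r y := hU₂c.uncurry_right y
    have hint : HasDerivAt (fun s => ∫ r in τ..s, U₂ r y) (U₂ τ y) τ :=
      intervalIntegral.integral_hasDerivAt_right (hU₂y.intervalIntegrable _ _)
        (hU₂y.stronglyMeasurableAtFilter _ _) hU₂y.continuousAt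
    have hlin : HasDerivAt (fun s : ℝ => c * (s - τ)) c τ := by
      simpa using ((hasDerivAt_id τ).sub_const τ).const_mul c
    refine deriv_nonpos_of_eventually_nonneg_left
      (G := fun s => (ψ s y - ψ τ y) + c * (s - τ) - ∫ r in τ..s, U₂ r y) (t := τ)
      ((((hder τ hτ' y hy').2.2.1.sub_const _).add hlin).sub hint) (by simp) ?_
    filter_upwards [Ioo_mem_nhdsLT (show τ - δ₁ < τ by linarith)] with s hs
    have e1 := hinc s hs.1 hs.2
    have e2 := hmax' s ⟨by linarith [hs.1], by linarith [hs.2, hτ.2]⟩ y hy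
    rw [intervalIntegral.integral_symm]
    linarith
  have := (hder τ hτ' y hy').2.2.2
  linarith

/-! ### Barriers and caloric functions -/

/-- The odd cubic heat polynomial, scaled so that at time `0` it equals `x` at `x = b`. -/
def cubicBarrier (b s x : ℝ) : ℝ := (x ^ 3 + 6 * x * s) / b ^ 2

theorem IsHeatSuper.cubicBarrier (t₁ t₂ b : ℝ) :
    IsHeatSuper t₁ t₂ b (fun t x => cubicBarrier b (t - t₁) x) := by
  unfold _root_.cubicBarrier
  refine ⟨?_, fun t x => (3 * x ^ 2 + 6 * (t - t₁)) / b ^ 2, fun t x => 6 * x / b ^ 2,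
    fun t x => 6 * x / b ^ 2, fun t _ x _ => ⟨?_, ?_, ?_, le_rfl⟩⟩
  · unfold Function.uncurry; fun_prop
  · have h := (((hasDerivAt_id x).pow 3).add
      (((hasDerivAt_id x).const_mul 6).mul_const (t - t₁))).div_const (b ^ 2)
    refine h.congr_deriv ?_
    simp
  · have h := ((((hasDerivAt_id x).pow 2).const_mul 3).add_const (6 * (t - t₁))).div_const (b ^ 2)
    refine h.congr_deriv ?_
    simp; ring
  · have h := ((((hasDerivAt_id t).sub_const t₁).const_mul (6 * x)).const_add (x ^ 3)).div_const
      (b ^ 2)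
    refine h.congr_deriv ?_
    simp

/-- A supersolution of the heat equation which initially dominates a multiple of `x` for `x ≤ r`,
and whose slope at `x = 0` has dropped to `r² / (s + r²)` at time `s`. The caloric function of this
shape has the factor `(s + r²)^(-3/2)`; the exponent `-1` is chosen to avoid fractional powers. -/
def concentratedBarrier (r s x : ℝ) : ℝ :=
  r ^ 2 * x / (s + r ^ 2) * Real.exp (-x ^ 2 / (4 * (s + r ^ 2)))

theorem IsHeatSuper.concentratedBarrier (t₁ t₂ b : ℝ) {r : ℝ} (hr : 0 < r) :
    IsHeatSuper t₁ t₂ b (fun t x => concentratedBarrier r (t - t₁) x) := by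
  unfold _root_.concentratedBarrier
  refine ⟨?_, fun t x => r ^ 2 / (t - t₁ + r ^ 2) * (1 - x ^ 2 / (2 * (t - t₁ + r ^ 2))) *
      Real.exp (-x ^ 2 / (4 * (t - t₁ + r ^ 2))),
    fun t x => r ^ 2 / (t - t₁ + r ^ 2) * (-(3 * x) / (2 * (t - t₁ + r ^ 2)) +
      x ^ 3 / (4 * (t - t₁ + r ^ 2) ^ 2)) * Real.exp (-x ^ 2 / (4 * (t - t₁ + r ^ 2))),
    fun t x => r ^ 2 / (t - t₁ + r ^ 2) * (-x / (t - t₁ + r ^ 2) +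
      x ^ 3 / (4 * (t - t₁ + r ^ 2) ^ 2)) * Real.exp (-x ^ 2 / (4 * (t - t₁ + r ^ 2))),
    fun t ht x hx => ?_⟩
  · intro p hp
    have h0 : 0 < p.1 - t₁ + r ^ 2 := by
      have : t₁ ≤ p.1 := hp.1.1
      have : 0 < r ^ 2 := by positivity
      linarith
    refine ContinuousAt.continuousWithinAt ?_
    unfold Function.uncurry
    exact ContinuousAt.mul (ContinuousAt.div (by fun_prop) (by fun_prop) h0.ne')
      (ContinuousAt.rexp (ContinuousAt.div (by fun_prop) (by fun_prop) (by positivity)))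
  · have h0 : 0 < t - t₁ + r ^ 2 := by
      have : t₁ < t := ht.1
      have : 0 < r ^ 2 := by positivity
      linarith
    set σ := t - t₁ + r ^ 2 with hσ
    have hexp : HasDerivAt (fun x => Real.exp (-x ^ 2 / (4 * σ)))
        (Real.exp (-x ^ 2 / (4 * σ)) * (-(2 * x) / (4 * σ))) x := by
      have h := (((hasDerivAt_id x).pow 2).neg.div_const (4 * σ)).exp
      refine h.congr_deriv ?_
      simp
    refine ⟨?_, ?_, ?_, ?_⟩
    · have h := (((hasDerivAt_id x).const_mul (r ^ 2)).div_const σ).mul hexp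
      refine h.congr_deriv ?_
      simp only [id, ← hσ]
      generalize Real.exp (-x ^ 2 / (4 * σ)) = E
      clear_value σ
      field_simp
      ring
    · have h := (((((hasDerivAt_id x).pow 2).div_const (2 * σ)).const_sub 1).const_mul
        (r ^ 2 / σ)).mul hexp
      refine h.congr_deriv ?_
      simp only [id, ← hσ, Pi.pow_apply]
      generalize Real.exp (-x ^ 2 / (4 * σ)) = E
      clear_value σ
      field_simp
      simp
      ring
    · have hs : HasDerivAt (fun s : ℝ => s - t₁ + r ^ 2) 1 t :=
        ((hasDerivAt_id t).sub_const t₁).add_const _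
      have h := ((hasDerivAt_const t (r ^ 2 * x)).div hs h0.ne').mul
        (((hasDerivAt_const t (-x ^ 2)).div (hs.const_mul 4) (by positivity)).exp)
      refine h.congr_deriv ?_
      simp only [← hσ, Pi.div_apply]
      generalize Real.exp (-x ^ 2 / (4 * σ)) = E
      clear_value σ
      field_simp
      ring
    · refine mul_le_mul_of_nonneg_right (mul_le_mul_of_nonneg_left ?_ (by positivity))
        (Real.exp_pos _).le
      have : 0 ≤ x / σ := div_nonneg hx.1.le h0.le
      have e : -(3 * x) / (2 * σ) = -(3 / 2) * (x / σ) := by field_simp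
      rw [e, neg_div]
      linarith

/-- `f` is the initial value of a classical solution `p` of the heat equation on `ℝ × ℝ`, vanishing
at `x = ρ`, such that `p(s,x) / x` extends continuously to `x = 0`. -/
def OddCaloric (ρ : ℝ) (f : ℝ → ℝ) : Prop :=
  ∃ p px pt g : ℝ → ℝ → ℝ, Continuous (Function.uncurry g) ∧ (∀ s x, p s x = x * g s x) ∧
    (∀ x, p 0 x = f x) ∧ (∀ s, p s ρ = 0) ∧ ∀ s x, HasDerivAt (p s) (px s x) x ∧
      HasDerivAt (px s) (pt s x) x ∧ HasDerivAt (fun r => p r x) (pt s x) s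

namespace OddCaloric

variable {ρ : ℝ} {f f' : ℝ → ℝ}

theorem add (h : OddCaloric ρ f) (h' : OddCaloric ρ f') : OddCaloric ρ (fun x => f x + f' x) := by
  obtain ⟨p, px, pt, g, hg, hp, hf, hρ, hd⟩ := h
  obtain ⟨q, qx, qt, k, hk, hq, hf', hρ', hd'⟩ := h'
  refine ⟨fun s x => p s x + q s x, fun s x => px s x + qx s x, fun s x => pt s x + qt s x,
    fun s x => g s x + k s x, hg.add hk, ?_, ?_, ?_, fun s x => ?_⟩
  · intro s x; dsimp only; rw [hp, hq, mul_add]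
  · intro x; dsimp only; rw [hf, hf']
  · intro s; dsimp only; rw [hρ, hρ', add_zero]
  · exact ⟨(hd s x).1.add (hd' s x).1, (hd s x).2.1.add (hd' s x).2.1,
      (hd s x).2.2.add (hd' s x).2.2⟩

theorem const_mul (h : OddCaloric ρ f) (c : ℝ) : OddCaloric ρ (fun x => c * f x) := by
  obtain ⟨p, px, pt, g, hg, hp, hf, hρ, hd⟩ := h
  refine ⟨fun s x => c * p s x, fun s x => c * px s x, fun s x => c * pt s x,
    fun s x => c * g s x, hg.const_mul c, ?_, ?_, ?_, fun s x => ?_⟩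
  · intro s x; dsimp only; rw [hp]; ring
  · intro x; dsimp only; rw [hf]
  · intro s; dsimp only; rw [hρ, mul_zero]
  · exact ⟨(hd s x).1.const_mul c, (hd s x).2.1.const_mul c, (hd s x).2.2.const_mul c⟩

theorem sin_int_mul (hρ : ρ ≠ 0) (k : ℤ) :
    OddCaloric ρ (fun x => Real.sin (k * (Real.pi / ρ * x))) := by
  set κ : ℝ := k * (Real.pi / ρ) with hκ
  have e : ∀ x, (k : ℝ) * (Real.pi / ρ * x) = κ * x := fun x => by rw [hκ]; ring
  simp only [e]
  have hsin : ∀ x, HasDerivAt (fun x => Real.sin (κ * x)) (κ * Real.cos (κ * x)) x := fun x => by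
    have := ((hasDerivAt_id x).const_mul κ).sin
    simpa [mul_comm] using this
  have hcos : ∀ x, HasDerivAt (fun x => Real.cos (κ * x)) (-(κ * Real.sin (κ * x))) x := fun x => by
    have := ((hasDerivAt_id x).const_mul κ).cos
    simpa [mul_comm] using this
  refine ⟨fun s x => Real.exp (-κ ^ 2 * s) * Real.sin (κ * x),
    fun s x => Real.exp (-κ ^ 2 * s) * (κ * Real.cos (κ * x)),
    fun s x => Real.exp (-κ ^ 2 * s) * (κ * -(κ * Real.sin (κ * x))),
    fun s x => Real.exp (-κ ^ 2 * s) * (κ * Real.sinc (κ * x)), ?_, ?_, ?_, ?_, fun s x => ?_⟩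
  · have := Real.continuous_sinc
    unfold Function.uncurry
    fun_prop
  · intro s x
    dsimp only
    rcases eq_or_ne (κ * x) 0 with h | h
    · rw [h]
      simp only [Real.sin_zero, mul_zero, Real.sinc_zero]
      linear_combination -(Real.exp (-κ ^ 2 * s)) * h
    · rw [Real.sinc_of_ne_zero h]
      have h1 : κ ≠ 0 := left_ne_zero_of_mul h
      have h2 : x ≠ 0 := right_ne_zero_of_mul h
      field_simp
  · intro x; simp
  · intro s
    have : κ * ρ = k * Real.pi := by rw [hκ]; field_simp
    simp [this]
  · refine ⟨(hsin x).const_mul _, ((hcos x).const_mul κ).const_mul _, ?_⟩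
    have := (((hasDerivAt_id s).const_mul (-κ ^ 2)).exp).mul_const (Real.sin (κ * x))
    refine this.congr_deriv ?_
    simp; ring

/-- Multiplication by `cos(πx/ρ)` maps `sin(kπx/ρ)` to a combination of `sin((k ± 1)πx/ρ)`. -/
theorem cos_pow_mul_sin (hρ : ρ ≠ 0) (n : ℕ) : ∀ k : ℤ, OddCaloric ρ (fun x =>
    Real.cos (Real.pi / ρ * x) ^ n * Real.sin (k * (Real.pi / ρ * x))) := by
  induction n with
  | zero => intro k; simpa using sin_int_mul hρ k
  | succ n ih =>
    intro k
    convert ((ih (k + 1)).add (ih (k - 1))).const_mul (1 / 2) using 2 with x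
    have h1 : ((k + 1 : ℤ) : ℝ) * (Real.pi / ρ * x) = k * (Real.pi / ρ * x) + Real.pi / ρ * x := by
      push_cast; ring
    have h2 : ((k - 1 : ℤ) : ℝ) * (Real.pi / ρ * x) = k * (Real.pi / ρ * x) - Real.pi / ρ * x := by
      push_cast; ring
    rw [h1, h2, Real.sin_add, Real.sin_sub]
    ring

theorem polynomial_cos_mul_sin (hρ : ρ ≠ 0) (q : Polynomial ℝ) : OddCaloric ρ (fun x =>
    q.eval (Real.cos (Real.pi / ρ * x)) * Real.sin (Real.pi / ρ * x)) := by
  induction q using Polynomial.induction_on' with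
  | add p q hp hq => convert hp.add hq using 2 with x; simp [add_mul]
  | monomial n c =>
    convert (cos_pow_mul_sin hρ n 1).const_mul c using 2 with x
    simp; ring

/-- A function with `|w x| ≤ C x` is approximated by initial values of odd caloric functions, with
an error which is a small multiple of `x` off a neighbourhood of the ends of `[0,ρ]`. -/
theorem exists_approx {w : ℝ → ℝ} (hw : Continuous w) {C r ε : ℝ} (hρ : 0 < ρ) (hr : 0 < r)
    (hrρ : r ≤ ρ / 2) (hε : 0 < ε) (hC : ∀ x ∈ Icc 0 ρ, |w x| ≤ C * x) :
    ∃ f, OddCaloric ρ f ∧ (∀ x ∈ Icc 0 ρ, |f x - w x| ≤ (ε + 3 * C) * x) ∧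
      ∀ x ∈ Icc r (ρ / 2), |f x - w x| ≤ ε * x := by
  have hπ := Real.pi_pos
  have hC0 : 0 ≤ C := by
    have := (abs_nonneg _).trans (hC ρ ⟨hρ.le, le_rfl⟩)
    exact nonneg_of_mul_nonneg_left this hρ
  set l := Real.pi / ρ with hl
  have hl0 : 0 < l := by positivity
  have hsinlow : ∀ x ∈ Icc r (ρ / 2), 2 / ρ * x ≤ Real.sin (l * x) := by
    intro x hx
    have h := Real.mul_le_sin (x := l * x) (mul_nonneg hl0.le (hr.le.trans hx.1)) (by
      rw [hl, div_mul_eq_mul_div, div_le_div_iff₀ hρ two_pos]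
      nlinarith [hx.2])
    refine le_trans (le_of_eq ?_) h
    rw [hl]; field_simp
  have hsinup : ∀ x ∈ Icc 0 ρ, 0 ≤ Real.sin (l * x) ∧ Real.sin (l * x) ≤ 4 / ρ * x := by
    intro x hx
    have h0 : 0 ≤ l * x := mul_nonneg hl0.le hx.1
    refine ⟨Real.sin_nonneg_of_nonneg_of_le_pi h0 ?_, (Real.sin_le h0).trans ?_⟩
    · rw [hl, div_mul_eq_mul_div, div_le_iff₀ hρ]
      exact mul_le_mul_of_nonneg_left hx.2 hπ.le
    · refine mul_le_mul_of_nonneg_right ?_ hx.1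
      exact div_le_div_of_nonneg_right Real.pi_le_four hρ.le
  -- `cl` clamps to `[r, ρ/2]`.
  set cl : ℝ → ℝ := fun x => max r (min x (ρ / 2)) with hcl
  have hclmem : ∀ x, cl x ∈ Icc r (ρ / 2) := fun x =>
    ⟨le_max_left _ _, max_le hrρ (min_le_right _ _)⟩
  have hcl_eq : ∀ x ∈ Icc r (ρ / 2), cl x = x := fun x hx => by
    simp only [hcl]; rw [min_eq_left hx.2, max_eq_right hx.1]
  have hsinpos : ∀ x, 0 < Real.sin (l * cl x) := fun x =>
    lt_of_lt_of_le (mul_pos (by positivity) (hr.trans_le (hclmem x).1)) (hsinlow _ (hclmem x))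
  set G : ℝ → ℝ := fun x => w (cl x) / Real.sin (l * cl x) with hG
  have hclc : Continuous cl := by fun_prop
  have hGc : Continuous G := (hw.comp hclc).div (by fun_prop) fun x => (hsinpos x).ne'
  have hGle : ∀ x, |G x| ≤ C * ρ / 2 := by
    intro x
    have hm := hclmem x
    simp only [hG, abs_div, abs_of_pos (hsinpos x)]
    rw [div_le_iff₀ (hsinpos x)]
    have h1 := hC (cl x) ⟨hr.le.trans hm.1, by linarith [hm.2]⟩
    have h2 := mul_le_mul_of_nonneg_left (hsinlow _ hm) (show 0 ≤ C * ρ / 2 by positivity)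
    refine h1.trans (le_trans (le_of_eq ?_) h2)
    field_simp
  -- Weierstrass approximation in the variable `cos (π x / ρ)`.
  obtain ⟨q, hq⟩ := exists_polynomial_near_of_continuousOn (-1) 1
    (fun y => G (Real.arccos y / l)) (hGc.comp (by fun_prop)).continuousOn
    (ε * ρ / 4) (by positivity)
  have hqx : ∀ x ∈ Icc 0 ρ, |q.eval (Real.cos (l * x)) - G x| ≤ ε * ρ / 4 := by
    intro x hx
    have h := hq (Real.cos (l * x)) ⟨Real.neg_one_le_cos _, Real.cos_le_one _⟩
    have h3 : l * x ≤ Real.pi := by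
      rw [hl, div_mul_eq_mul_div, div_le_iff₀ hρ]
      exact mul_le_mul_of_nonneg_left hx.2 hπ.le
    simp only [Real.arccos_cos (mul_nonneg hl0.le hx.1) h3, mul_div_cancel_left₀ x hl0.ne'] at h
    exact h.le
  have herr : ∀ x ∈ Icc 0 ρ,
      |q.eval (Real.cos (l * x)) * Real.sin (l * x) - G x * Real.sin (l * x)| ≤ ε * x := by
    intro x hx
    rw [← sub_mul, abs_mul, abs_of_nonneg (hsinup x hx).1]
    refine (mul_le_mul (hqx x hx) (hsinup x hx).2 (hsinup x hx).1 (by positivity)).trans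
      (le_of_eq ?_)
    field_simp
  refine ⟨_, polynomial_cos_mul_sin hρ.ne' q, fun x hx => ?_, fun x hx => ?_⟩
  · have h1 := herr x hx
    have h2 := hC x hx
    have h3 : |G x * Real.sin (l * x)| ≤ 2 * C * x := by
      rw [abs_mul, abs_of_nonneg (hsinup x hx).1]
      refine (mul_le_mul (hGle x) (hsinup x hx).2 (hsinup x hx).1 (by positivity)).trans
        (le_of_eq ?_)
      field_simp
      ring
    rw [abs_le] at *
    constructor <;> linarith [h1.1, h1.2, h2.1, h2.2, h3.1, h3.2]
  · have h1 := herr x ⟨hr.le.trans hx.1, by linarith [hx.2]⟩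
    have h2 : G x * Real.sin (l * x) = w x := by
      have := (hsinpos x).ne'
      simp only [hG]
      rw [hcl_eq x hx] at this ⊢
      field_simp
    rwa [h2] at h1

end OddCaloric

/-! ### Slope of the solution at the spatial boundary point `0` -/

theorem cubicBarrier_nonneg {b s x : ℝ} (hs : 0 ≤ s) (hx : 0 ≤ x) : 0 ≤ cubicBarrier b s x := by
  unfold cubicBarrier; positivity

theorem le_cubicBarrier_right {b s : ℝ} (hb : 0 < b) (hs : 0 ≤ s) : b ≤ cubicBarrier b s b := by
  rw [cubicBarrier, le_div_iff₀ (by positivity)]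
  have : 0 ≤ 6 * b * s := by positivity
  nlinarith

theorem le_cubicBarrier_zero {b x : ℝ} (hb : 0 < b) (hx : b / 2 ≤ x) :
    x ≤ 4 * cubicBarrier b 0 x := by
  have h0 : 0 < x := by linarith
  rw [cubicBarrier, ← mul_div_assoc, le_div_iff₀ (by positivity)]
  have : b ^ 2 ≤ (2 * x) ^ 2 := by gcongr; linarith
  nlinarith

theorem cubicBarrier_le {b s x a : ℝ} (hx : 0 ≤ x) (h : x ^ 2 + 6 * s ≤ a * b ^ 2) (hb : 0 < b) :
    cubicBarrier b s x ≤ a * x := by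
  rw [cubicBarrier, div_le_iff₀ (by positivity)]
  nlinarith

theorem concentratedBarrier_nonneg {r s x : ℝ} (hs : 0 ≤ s) (hx : 0 ≤ x) :
    0 ≤ concentratedBarrier r s x := by
  unfold concentratedBarrier; positivity

theorem le_concentratedBarrier_zero {r x : ℝ} (hr : 0 < r) (hx : 0 ≤ x) (hxr : x ≤ r) :
    x ≤ 2 * concentratedBarrier r 0 x := by
  have h1 : x ^ 2 / r ^ 2 ≤ 1 := by
    rw [div_le_one (by positivity)]; gcongr
  have h2 : -x ^ 2 / (4 * (0 + r ^ 2)) = -(x ^ 2 / r ^ 2) / 4 := by field_simp; ring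
  have h3 := Real.add_one_le_exp (-x ^ 2 / (4 * (0 + r ^ 2)))
  have h4 : r ^ 2 * x / (0 + r ^ 2) = x := by field_simp; ring
  rw [concentratedBarrier, h4]
  rw [h2] at h3 ⊢
  nlinarith

theorem concentratedBarrier_le {r s x a : ℝ} (hs : 0 < s) (hx : 0 ≤ x) (h : r ^ 2 ≤ a * s) :
    concentratedBarrier r s x ≤ a * x := by
  have hr : 0 ≤ r ^ 2 := sq_nonneg r
  have ha : 0 ≤ a := nonneg_of_mul_nonneg_left (hr.trans h) hs
  have h1 : Real.exp (-x ^ 2 / (4 * (s + r ^ 2))) ≤ 1 := by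
    rw [Real.exp_le_one_iff]
    exact div_nonpos_of_nonpos_of_nonneg (by nlinarith) (by positivity)
  refine (mul_le_of_le_one_right (by positivity) h1).trans ?_
  rw [div_le_iff₀ (by positivity)]
  nlinarith [mul_nonneg (mul_nonneg ha hr) hx, mul_le_mul_of_nonneg_right h hx]

namespace WeakHeat

variable {T : ℝ} {w z : ℝ → ℝ → ℝ} {η : Measure (Ioo (0 : ℝ) 1 × Icc (0 : ℝ) T)}

/-- A lower bound for `w` needs no information on `η`, which only pushes `w` up. -/
theorem neg_le_of_super (h : WeakHeat T w η) {t₁ t₂ b : ℝ} (ht₁ : 0 ≤ t₁) (ht₂ : t₂ ≤ T)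
    (hb1 : b ≤ 1) {ψ : ℝ → ℝ → ℝ} (hsuper : IsHeatSuper t₁ t₂ b ψ)
    (hinit : ∀ x ∈ Icc 0 b, -w t₁ x ≤ ψ t₁ x)
    (hleft : ∀ t ∈ Icc t₁ t₂, -w t 0 ≤ ψ t 0) (hright : ∀ t ∈ Icc t₁ t₂, -w t b ≤ ψ t b) :
    ∀ t ∈ Icc t₁ t₂, ∀ x ∈ Icc 0 b, -w t x ≤ ψ t x := by
  simpa using (WeakHeat.zero T).max_principle h ht₁ ht₂ hb1 hsuper (by simpa using hinit)
    (by simpa using hleft) (by simpa using hright) (by simp)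

/-- The obstacle only has to lie below a linear function which `ψ` dominates on the parabolic
boundary: being caloric, this function then lies below `ψ` in the interior too, so `w` does not
touch the obstacle where `w > ψ`. -/
theorem le_of_super (h : WeakHeat T w η) {t₁ t₂ b m : ℝ} (ht₁ : 0 ≤ t₁) (ht₂ : t₂ ≤ T)
    (hb1 : b ≤ 1) {ψ : ℝ → ℝ → ℝ} (hsuper : IsHeatSuper t₁ t₂ b ψ)
    (hη : η {p | z p.2 p.1 < w p.2 p.1} = 0)
    (hz : ∀ t ∈ Icc t₁ t₂, ∀ x ∈ Icc 0 b, z t x ≤ m * x)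
    (hinit : ∀ x ∈ Icc 0 b, w t₁ x ≤ ψ t₁ x ∧ m * x ≤ ψ t₁ x)
    (hleft : ∀ t ∈ Icc t₁ t₂, w t 0 ≤ ψ t 0 ∧ 0 ≤ ψ t 0)
    (hright : ∀ t ∈ Icc t₁ t₂, w t b ≤ ψ t b ∧ m * b ≤ ψ t b) :
    ∀ t ∈ Icc t₁ t₂, ∀ x ∈ Icc 0 b, w t x ≤ ψ t x := by
  have hm : ∀ t ∈ Icc t₁ t₂, ∀ x ∈ Icc 0 b, m * x ≤ ψ t x := by
    intro t ht x hx
    have := (WeakHeat.zero T).max_principle (WeakHeat.zero T) ht₁ ht₂ hb1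
      (hsuper.add (IsHeatSuper.linear t₁ t₂ b (-m)))
      (fun x hx => by linarith [(hinit x hx).2]) (fun t ht => by linarith [(hleft t ht).2])
      (fun t ht => by linarith [(hright t ht).2]) (by simp) t ht x hx
    linarith
  have := h.max_principle (WeakHeat.zero T) ht₁ ht₂ hb1 hsuper
    (fun x hx => by linarith [(hinit x hx).1]) (fun t ht => by linarith [(hleft t ht).1])
    (fun t ht => by linarith [(hright t ht).1]) (measure_mono_null ?_ hη)
  · simpa using this
  · rintro p ⟨hp1, hp2, hp3⟩
    have hp : (p.1 : ℝ) ∈ Icc 0 b := ⟨p.1.2.1.le, hp2⟩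
    have h1 := hz _ hp1 _ hp
    have h2 := hm _ hp1 _ hp
    change z p.2 p.1 < w p.2 p.1
    linarith

/-- At time `0` the slope of `w` is `0`: since `z ≤ w = 0` initially, the slope `a` of the obstacle
is at most `ε`, so `2 ε x` dominates the obstacle near the corner. -/
theorem exists_slope_initial (h : WeakHeat T w η) {C ε a δ₀ : ℝ}
    (hC : ∀ t ∈ Icc 0 T, ∀ x ∈ Icc (0 : ℝ) 1, |w t x| ≤ C * x)
    (hzw : ∀ t ∈ Icc 0 T, ∀ x ∈ Icc (0 : ℝ) 1, z t x ≤ w t x)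
    (hη : η {p | z p.2 p.1 < w p.2 p.1} = 0) (hw0 : ∀ x ∈ Icc (0 : ℝ) 1, w 0 x = 0)
    (hT : 0 ≤ T) (hε : 0 < ε) (hδ₀ : 0 < δ₀)
    (hz : ∀ t ∈ Icc 0 T, t < δ₀ → ∀ x ∈ Icc (0 : ℝ) 1, x < δ₀ → |z t x - a * x| ≤ ε * x) :
    ∃ δ > 0, ∀ t ∈ Icc 0 T, t < δ → ∀ x ∈ Icc (0 : ℝ) 1, x < δ → |w t x| ≤ 6 * ε * x := by
  have hC0 : 0 ≤ C := by
    have := (abs_nonneg _).trans (hC 0 ⟨le_rfl, hT⟩ 1 ⟨zero_le_one, le_rfl⟩)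
    linarith
  obtain ⟨ρ, hρ, hρ1, hρδ⟩ : ∃ ρ > 0, ρ ≤ 1 ∧ ρ < δ₀ :=
    ⟨min 1 (δ₀ / 2), by positivity, min_le_left _ _,
      (min_le_right _ _).trans_lt (by linarith)⟩
  set t₂ := min T (δ₀ / 2) with ht₂
  have ht₂T : t₂ ≤ T := min_le_left _ _
  have ht₂δ : t₂ < δ₀ := (min_le_right _ _).trans_lt (by linarith)
  have hmem : ∀ t ∈ Icc 0 t₂, t ∈ Icc 0 T := fun t ht => ⟨ht.1, ht.2.trans ht₂T⟩
  have hxm : ∀ x ∈ Icc 0 ρ, x ∈ Icc (0 : ℝ) 1 := fun x hx => ⟨hx.1, hx.2.trans hρ1⟩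
  have ha : a ≤ ε := by
    have h1 := hz 0 ⟨le_rfl, hT⟩ hδ₀ ρ (hxm ρ ⟨hρ.le, le_rfl⟩) hρδ
    have h2 := hzw 0 ⟨le_rfl, hT⟩ ρ (hxm ρ ⟨hρ.le, le_rfl⟩)
    rw [hw0 ρ (hxm ρ ⟨hρ.le, le_rfl⟩)] at h2
    have h3 := (abs_le.1 h1).1
    by_contra! hcon
    nlinarith
  have hB0 : ∀ t ∈ Icc 0 t₂, 0 ≤ cubicBarrier ρ (t - 0) 0 := fun t ht =>
    cubicBarrier_nonneg (by linarith [ht.1]) le_rfl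
  have hBρ : ∀ t ∈ Icc 0 t₂, C * ρ ≤ C * cubicBarrier ρ (t - 0) ρ := fun t ht =>
    mul_le_mul_of_nonneg_left (le_cubicBarrier_right hρ (by linarith [ht.1])) hC0
  have hBi : ∀ x ∈ Icc 0 ρ, 0 ≤ C * cubicBarrier ρ (0 - 0) x := fun x hx =>
    mul_nonneg hC0 (cubicBarrier_nonneg (by simp) hx.1)
  have hw00 : ∀ t ∈ Icc 0 t₂, w t 0 = 0 := fun t ht => by
    simpa using hC t (hmem t ht) 0 ⟨le_rfl, zero_le_one⟩
  have hsup := ((IsHeatSuper.cubicBarrier 0 t₂ ρ).const_mul hC0)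
  have hlow := h.neg_le_of_super le_rfl ht₂T hρ1 hsup
    (fun x hx => by rw [hw0 x (hxm x hx), neg_zero]; exact hBi x hx)
    (fun t ht => by rw [hw00 t ht, neg_zero]; exact mul_nonneg hC0 (hB0 t ht))
    (fun t ht => (neg_le_abs _).trans ((hC t (hmem t ht) ρ ⟨hρ.le, hρ1⟩).trans (hBρ t ht)))
  have hup := h.le_of_super (m := 2 * ε) le_rfl ht₂T hρ1
    (hsup.add (IsHeatSuper.linear 0 t₂ ρ (2 * ε))) hη
    (fun t ht x hx => by
      have := (abs_le.1 (hz t (hmem t ht) (ht.2.trans_lt ht₂δ) x (hxm x hx)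
        (hx.2.trans_lt hρδ))).2
      nlinarith [hx.1])
    (fun x hx => by
      have h1 := hBi x hx
      have h2 : 0 ≤ 2 * ε * x := mul_nonneg (by positivity) hx.1
      rw [hw0 x (hxm x hx)]
      constructor <;> linarith)
    (fun t ht => by
      have h1 := mul_nonneg hC0 (hB0 t ht)
      rw [hw00 t ht]
      constructor <;> linarith)
    (fun t ht => by
      have h1 := hBρ t ht
      have h2 := (abs_le.1 (hC t (hmem t ht) ρ ⟨hρ.le, hρ1⟩)).2
      have h3 : 0 ≤ 2 * ε * ρ := by positivity
      have h4 : 0 ≤ C * ρ := by positivity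
      constructor <;> linarith)
  -- Near the corner the cubic barrier is at most `ε x / (C + 1)`.
  set κ := ε * ρ ^ 2 / (7 * (C + 1)) with hκ
  have hκ0 : 0 < κ := by positivity
  refine ⟨min (min κ 1) (min ρ (δ₀ / 2)), by positivity, fun t ht htδ x hx hxδ => ?_⟩
  obtain ⟨⟨ht1, -⟩, -, ht2⟩ := by simpa only [lt_min_iff] using htδ
  obtain ⟨⟨hx1, hx2⟩, hx3, -⟩ := by simpa only [lt_min_iff] using hxδ
  have ht' : t ∈ Icc 0 t₂ := ⟨ht.1, le_min ht.2 ht2.le⟩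
  have hx' : x ∈ Icc 0 ρ := ⟨hx.1, hx3.le⟩
  have hB : C * cubicBarrier ρ (t - 0) x ≤ ε * x := by
    have h1 : cubicBarrier ρ (t - 0) x ≤ ε / (C + 1) * x := by
      refine cubicBarrier_le hx.1 ?_ hρ
      have e : ε / (C + 1) * ρ ^ 2 = 7 * κ := by rw [hκ]; field_simp
      rw [e]
      nlinarith [hx.1]
    have h2 : C * (ε / (C + 1) * x) ≤ ε * x := by
      have : C / (C + 1) ≤ 1 := by rw [div_le_one (by positivity)]; linarith
      calc C * (ε / (C + 1) * x) = C / (C + 1) * (ε * x) := by field_simp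
        _ ≤ 1 * (ε * x) := mul_le_mul_of_nonneg_right this (mul_nonneg hε.le hx.1)
        _ = ε * x := one_mul _
    exact (mul_le_mul_of_nonneg_left h1 hC0).trans h2
  have h1 := hlow t ht' x hx'
  have h2 := hup t ht' x hx'
  have h3 : 0 ≤ ε * x := mul_nonneg hε.le hx.1
  rw [abs_le]
  constructor <;> linarith

/-- At a positive time `t₀`, the caloric function with initial value close to `w(t₀ - τ, ·)` is
within a small multiple of `x` of `w`, and its slope at `(t₀, 0)` serves as `L`. -/
theorem exists_slope_pos (h : WeakHeat T w η) {C ε a δ₀ t₀ : ℝ}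
    (hC : ∀ t ∈ Icc 0 T, ∀ x ∈ Icc (0 : ℝ) 1, |w t x| ≤ C * x)
    (hzw : ∀ t ∈ Icc 0 T, ∀ x ∈ Icc (0 : ℝ) 1, z t x ≤ w t x)
    (hη : η {p | z p.2 p.1 < w p.2 p.1} = 0)
    (ht₀ : 0 < t₀) (ht₀T : t₀ ≤ T) (hε : 0 < ε) (hδ₀ : 0 < δ₀)
    (hz : ∀ t ∈ Icc 0 T, |t - t₀| < δ₀ → ∀ x ∈ Icc (0 : ℝ) 1, x < δ₀ → |z t x - a * x| ≤ ε * x) :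
    ∃ L, ∃ δ > 0, ∀ t ∈ Icc 0 T, |t - t₀| < δ → ∀ x ∈ Icc (0 : ℝ) 1, x < δ →
      |w t x - L * x| ≤ 6 * ε * x := by
  have hC0 : 0 ≤ C := by
    have := (abs_nonneg _).trans (hC t₀ ⟨ht₀.le, ht₀T⟩ 1 ⟨zero_le_one, le_rfl⟩)
    linarith
  obtain ⟨ρ, hρ, hρ1, hρδ⟩ : ∃ ρ > 0, ρ ≤ 1 ∧ ρ < δ₀ :=
    ⟨min 1 (δ₀ / 2), by positivity, min_le_left _ _,
      (min_le_right _ _).trans_lt (by linarith)⟩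
  -- The time step `τ` is so small that the lateral data at `x = ρ` are not felt near `x = 0`, the
  -- length `r ≪ √τ` so small that the initial data on `[0,r]` are forgotten after time `τ / 2`.
  obtain ⟨τ, hτ, hτt, hτδ, hτC⟩ : ∃ τ > 0, τ ≤ t₀ ∧ τ < δ₀ ∧ 120 * (C + 1) * τ ≤ ε * ρ ^ 2 := by
    refine ⟨min t₀ (min (δ₀ / 2) (ε * ρ ^ 2 / (120 * (C + 1)))), by positivity, min_le_left _ _,
      ((min_le_right _ _).trans (min_le_left _ _)).trans_lt (by linarith), ?_⟩
    rw [← le_div_iff₀' (by positivity)]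
    exact (min_le_right _ _).trans (min_le_right _ _)
  obtain ⟨r, hr, hrρ, hrC⟩ : ∃ r > 0, r ≤ ρ / 2 ∧ 12 * (C + 1) * r ^ 2 ≤ ε * τ := by
    refine ⟨min (ρ / 2) (ε * τ / (12 * (C + 1))), by positivity, min_le_left _ _, ?_⟩
    set r := min (ρ / 2) (ε * τ / (12 * (C + 1))) with hr
    have h0 : 0 < r := by positivity
    have h1 : r ≤ 1 := (min_le_left _ _).trans (by linarith)
    rw [← le_div_iff₀' (by positivity)]
    exact le_trans (by nlinarith) (min_le_right (ρ / 2) _)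
  set t₁ := t₀ - τ with ht₁
  set t₂ := min T (t₀ + τ / 2) with ht₂
  have ht₁0 : 0 ≤ t₁ := by linarith
  have ht₂T : t₂ ≤ T := min_le_left _ _
  have ht₂τ : t₂ ≤ t₀ + τ / 2 := min_le_right _ _
  have hmem : ∀ t ∈ Icc t₁ t₂, t ∈ Icc 0 T := fun t ht => ⟨ht₁0.trans ht.1, ht.2.trans ht₂T⟩
  have hxm : ∀ x ∈ Icc 0 ρ, x ∈ Icc (0 : ℝ) 1 := fun x hx => ⟨hx.1, hx.2.trans hρ1⟩
  have ht₁m : t₁ ∈ Icc 0 T := ⟨ht₁0, by linarith⟩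
  have hzQ : ∀ t ∈ Icc t₁ t₂, ∀ x ∈ Icc 0 ρ, |z t x - a * x| ≤ ε * x := fun t ht x hx =>
    hz t (hmem t ht) (by rw [abs_lt]; constructor <;> linarith [ht.1, ht.2]) x (hxm x hx)
      (hx.2.trans_lt hρδ)
  obtain ⟨f, ⟨p, px, pt, g, hg, hpg, hpf, hpρ, hpd⟩, hf1, hf2⟩ :=
    OddCaloric.exists_approx (h.continuous.uncurry_left t₁) hρ hr hrρ hε
      (fun x hx => hC t₁ ht₁m x (hxm x hx))
  -- The common error term of the upper and lower barriers. At the initial time its two summands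
  -- dominate `3 C x` for `x ≤ r` and for `x ≥ ρ / 2`, where `p` does not approximate `w`.
  set E : ℝ → ℝ → ℝ := fun t x => 6 * C * concentratedBarrier r (t - t₁) x +
    12 * C * cubicBarrier ρ (t - t₁) x with hE
  have hEsup : IsHeatSuper t₁ t₂ ρ E :=
    ((IsHeatSuper.concentratedBarrier t₁ t₂ ρ hr).const_mul (by positivity)).add
      ((IsHeatSuper.cubicBarrier t₁ t₂ ρ).const_mul (by positivity))
  have hpc : Continuous (Function.uncurry fun t x => p (t - t₁) x) := by
    have : (Function.uncurry fun t x => p (t - t₁) x) =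
        fun q : ℝ × ℝ => q.2 * Function.uncurry g (q.1 - t₁, q.2) := by
      ext q; exact hpg _ _
    rw [this]
    fun_prop
  have htime : ∀ t x, HasDerivAt (fun s => p (s - t₁) x) (pt (t - t₁) x) t := fun t x => by
    simpa using (hpd (t - t₁) x).2.2.comp_sub_const t t₁
  have hpsup : IsHeatSuper t₁ t₂ ρ (fun t x => p (t - t₁) x) :=
    ⟨hpc.continuousOn, fun t => px (t - t₁), fun t => pt (t - t₁), fun t => pt (t - t₁),
      fun t _ x _ => ⟨(hpd _ x).1, (hpd _ x).2.1, htime t x, le_rfl⟩⟩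
  have hpsup' : IsHeatSuper t₁ t₂ ρ (fun t x => -p (t - t₁) x) :=
    ⟨hpc.neg.continuousOn, fun t x => -px (t - t₁) x, fun t x => -pt (t - t₁) x,
      fun t x => -pt (t - t₁) x,
      fun t _ x _ => ⟨(hpd _ x).1.neg, (hpd _ x).2.1.neg, (htime t x).neg, le_rfl⟩⟩
  have hE0 : ∀ t ∈ Icc t₁ t₂, 0 ≤ E t 0 := fun t ht => by
    have h1 := concentratedBarrier_nonneg (r := r) (sub_nonneg.2 ht.1) le_rfl
    have h2 := cubicBarrier_nonneg (b := ρ) (sub_nonneg.2 ht.1) le_rfl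
    simp only [hE]; positivity
  have hEρ : ∀ t ∈ Icc t₁ t₂, C * ρ ≤ E t ρ := fun t ht => by
    have h1 := concentratedBarrier_nonneg (r := r) (sub_nonneg.2 ht.1) hρ.le
    have h2 := le_cubicBarrier_right hρ (sub_nonneg.2 ht.1)
    have h3 : 0 ≤ 6 * C * concentratedBarrier r (t - t₁) ρ := by positivity
    have h4 := mul_le_mul_of_nonneg_left h2 (show 0 ≤ 12 * C by positivity)
    have h5 : 0 ≤ C * ρ := by positivity
    simp only [hE]; linarith
  have hEi : ∀ x ∈ Icc 0 ρ, |p (t₁ - t₁) x - w t₁ x| ≤ ε * x + E t₁ x := fun x hx => by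
    have h1 := concentratedBarrier_nonneg (r := r) (le_refl (0 : ℝ)) hx.1
    have h2 := cubicBarrier_nonneg (b := ρ) (le_refl (0 : ℝ)) hx.1
    have h3 : 0 ≤ 6 * C * concentratedBarrier r 0 x := by positivity
    have h4 : 0 ≤ 12 * C * cubicBarrier ρ 0 x := by positivity
    simp only [hE, sub_self, hpf]
    rcases le_or_gt x r with hxr | hxr
    · have h5 := mul_le_mul_of_nonneg_left (le_concentratedBarrier_zero hr hx.1 hxr)
        (show 0 ≤ 3 * C by positivity)
      linarith [hf1 x hx]
    · rcases le_or_gt x (ρ / 2) with hxρ | hxρ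
      · linarith [hf2 x ⟨hxr.le, hxρ⟩]
      · have h5 := mul_le_mul_of_nonneg_left (le_cubicBarrier_zero hρ hxρ.le)
          (show 0 ≤ 3 * C by positivity)
        linarith [hf1 x hx]
  have hw00 : ∀ t ∈ Icc t₁ t₂, w t 0 = 0 := fun t ht => by
    simpa using hC t (hmem t ht) 0 ⟨le_rfl, zero_le_one⟩
  have hp0 : ∀ s, p s 0 = 0 := fun s => by rw [hpg, zero_mul]
  have hlow := h.neg_le_of_super ht₁0 ht₂T hρ1
    ((hpsup'.add hEsup).add (IsHeatSuper.linear t₁ t₂ ρ ε))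
    (fun x hx => by linarith [(abs_le.1 (hEi x hx)).2])
    (fun t ht => by
      rw [hw00 t ht, hp0]; linarith [hE0 t ht])
    (fun t ht => by
      rw [hpρ]
      have := hEρ t ht
      have := (abs_le.1 (hC t (hmem t ht) ρ ⟨hρ.le, hρ1⟩)).1
      have : 0 ≤ ε * ρ := by positivity
      linarith)
  -- `(a + ε) x ≤ w + 2 ε x`, since `w` lies above the obstacle.
  have haw : ∀ t ∈ Icc t₁ t₂, ∀ x ∈ Icc 0 ρ, (a + ε) * x ≤ w t x + 2 * ε * x := by
    intro t ht x hx
    have h1 := (abs_le.1 (hzQ t ht x hx)).1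
    have h2 := hzw t (hmem t ht) x (hxm x hx)
    linarith
  have hbdry : ∀ t ∈ Icc t₁ t₂, ∀ x ∈ Icc 0 ρ, ∀ y, w t x + 2 * ε * x ≤ y →
      w t x ≤ y ∧ (a + ε) * x ≤ y := fun t ht x hx y hy =>
    ⟨by have : 0 ≤ 2 * ε * x := mul_nonneg (by positivity) hx.1
        linarith, (haw t ht x hx).trans hy⟩
  have ht₁₂ : t₁ ≤ t₂ := le_min (by linarith) (by linarith)
  have hup := h.le_of_super (m := a + ε) ht₁0 ht₂T hρ1
    ((hpsup.add hEsup).add (IsHeatSuper.linear t₁ t₂ ρ (3 * ε))) hη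
    (fun t ht x hx => by linarith [(abs_le.1 (hzQ t ht x hx)).2])
    (fun x hx => hbdry t₁ ⟨le_rfl, ht₁₂⟩ x hx _ (by linarith [(abs_le.1 (hEi x hx)).1]))
    (fun t ht => by
      have := hbdry t ht 0 ⟨le_rfl, hρ.le⟩ (p (t - t₁) 0 + E t 0 + 3 * ε * 0) (by
        rw [hw00 t ht, hp0]; linarith [hE0 t ht])
      rwa [mul_zero (a + ε)] at this)
    (fun t ht => hbdry t ht ρ ⟨hρ.le, le_rfl⟩ _ (by
      rw [hpρ]
      have := hEρ t ht
      have := (abs_le.1 (hC t (hmem t ht) ρ ⟨hρ.le, hρ1⟩)).2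
      have : 0 ≤ ε * ρ := by positivity
      linarith))
  obtain ⟨δ₁, hδ₁, hgδ⟩ := Metric.continuousAt_iff.1 (hg.continuousAt (x := (τ, (0 : ℝ)))) ε hε
  refine ⟨g τ 0, min (min δ₁ (τ / 2)) (min ρ (min τ 1)), by positivity,
    fun t ht htδ x hx hxδ => ?_⟩
  obtain ⟨⟨ht1, ht2⟩, -⟩ := by simpa only [lt_min_iff] using htδ
  obtain ⟨⟨hx1, -⟩, hx2, hx3, hx4⟩ := by simpa only [lt_min_iff] using hxδ
  have ht2' := abs_lt.1 ht2
  have ht' : t ∈ Icc t₁ t₂ := ⟨by linarith, le_min ht.2 (by linarith)⟩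
  have hx' : x ∈ Icc 0 ρ := ⟨hx.1, hx2.le⟩
  have hpL : |p (t - t₁) x - g τ 0 * x| ≤ ε * x := by
    have h1 : dist (Function.uncurry g (t - t₁, x)) (Function.uncurry g (τ, 0)) < ε := by
      refine hgδ (max_lt ?_ ?_)
      · change |t - t₁ - τ| < δ₁
        rwa [ht₁, show t - (t₀ - τ) - τ = t - t₀ by ring]
      · change |x - 0| < δ₁
        rwa [sub_zero, abs_of_nonneg hx.1]
    rw [hpg, mul_comm x, ← sub_mul, abs_mul, abs_of_nonneg hx.1]
    exact mul_le_mul_of_nonneg_right (le_of_lt h1) hx.1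
  have hC1 : C / (C + 1) ≤ 1 := by rw [div_le_one (by positivity)]; linarith
  have hscale : ∀ k > 0, k * C * (ε / (k * (C + 1)) * x) ≤ ε * x := fun k hk => by
    calc k * C * (ε / (k * (C + 1)) * x) = C / (C + 1) * (ε * x) := by field_simp
      _ ≤ 1 * (ε * x) := mul_le_mul_of_nonneg_right hC1 (mul_nonneg hε.le hx.1)
      _ = ε * x := one_mul _
  have hS : 6 * C * concentratedBarrier r (t - t₁) x ≤ ε * x := by
    refine (mul_le_mul_of_nonneg_left (concentratedBarrier_le (a := ε / (6 * (C + 1)))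
      (by linarith) hx.1 ?_) (by positivity)).trans (hscale 6 (by norm_num))
    rw [div_mul_eq_mul_div, le_div_iff₀ (by positivity)]
    nlinarith [mul_le_mul_of_nonneg_left (show τ / 2 ≤ t - t₁ by linarith) hε.le]
  have hB : 12 * C * cubicBarrier ρ (t - t₁) x ≤ ε * x := by
    refine (mul_le_mul_of_nonneg_left (cubicBarrier_le (a := ε / (12 * (C + 1)))
      hx.1 ?_ hρ) (by positivity)).trans (hscale 12 (by norm_num))
    rw [div_mul_eq_mul_div, le_div_iff₀ (by positivity)]
    have h1 : x ^ 2 + 6 * (t - t₁) ≤ 10 * τ := by nlinarith [hx.1]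
    nlinarith [mul_le_mul_of_nonneg_right h1 (show 0 ≤ 12 * (C + 1) by positivity)]
  have h1 := hlow t ht' x hx'
  have h2 := hup t ht' x hx'
  have h3 := abs_le.1 hpL
  have h4 : 0 ≤ ε * x := mul_nonneg hε.le hx.1
  simp only [hE] at h1 h2
  rw [abs_le]
  constructor <;> linarith [h3.1, h3.2]

end WeakHeat

/-! ### Solutions of the obstacle problem -/

/-- A function on `[0,T] × [0,1]`, extended to `ℝ × ℝ` by projecting onto the rectangle. -/
def extendRect {T : ℝ} (hT : 0 ≤ T) (w : Icc (0 : ℝ) T → Icc (0 : ℝ) 1 → ℝ) (t x : ℝ) : ℝ :=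
  w (projIcc 0 T hT t) (projIcc 0 1 zero_le_one x)

theorem extendRect_coe {T : ℝ} (hT : 0 ≤ T) (w : Icc (0 : ℝ) T → Icc (0 : ℝ) 1 → ℝ)
    (t : Icc (0 : ℝ) T) (x : Icc (0 : ℝ) 1) : extendRect hT w t x = w t x := by
  simp [extendRect]

theorem setIntegral_lebIcc (a b : ℝ) (f : ℝ → ℝ) {s : Set ℝ} (hs : MeasurableSet s) :
    ∫ x in {x : Icc a b | (x : ℝ) ∈ s}, f x ∂lebIcc a b = ∫ x in s ∩ Icc a b, f x := by
  have h := (MeasurableEmbedding.subtype_coe (measurableSet_Icc (a := a) (b := b))).setIntegral_map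
    (μ := lebIcc a b) f s
  rw [lebIcc, map_comap_subtype_coe measurableSet_Icc, Measure.restrict_restrict hs] at h
  exact h.symm

theorem integral_lebIcc {a b : ℝ} (hab : a ≤ b) (f : ℝ → ℝ) :
    ∫ x, f x ∂lebIcc a b = ∫ x in a..b, f x := by
  have h := setIntegral_lebIcc a b f MeasurableSet.univ
  simp only [mem_univ, univ_inter] at h
  rw [intervalIntegral.integral_of_le hab, ← integral_Icc_eq_integral_Ioc, ← h]
  exact setIntegral_univ.symm

namespace SolvesObstacleProblem

variable {T : ℝ} {z w z₁ z₂ w₁ w₂ : Icc (0 : ℝ) T → Icc (0 : ℝ) 1 → ℝ}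
  {η η₁ η₂ : Measure (Ioo (0 : ℝ) 1 × Icc (0 : ℝ) T)}

theorem weakHeat (hT : 0 ≤ T) (h : SolvesObstacleProblem T z w η) :
    WeakHeat T (extendRect hT w) η where
  continuous := h.continuous.comp (g := Function.uncurry w)
    (f := fun p : ℝ × ℝ => (projIcc 0 T hT p.1, projIcc 0 1 zero_le_one p.2))
    ((continuous_projIcc.comp continuous_fst).prodMk (continuous_projIcc.comp continuous_snd))
  integrable := h.integrable
  weak_equation φ hφ h0 h1 t ht := by
    have hx : ∀ (s : Icc (0 : ℝ) T) (g : ℝ → ℝ), ∫ x, w s x * g x ∂lebIcc 0 1 =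
        ∫ x in (0 : ℝ)..1, extendRect hT w s x * g x := by
      intro s g
      rw [← integral_lebIcc zero_le_one]
      simp only [extendRect_coe]
    have := h.weak_equation φ hφ h0 h1 ⟨t, ht⟩
    rw [hx] at this
    simp only [hx] at this
    rw [this]
    congr 1
    have h2 := setIntegral_lebIcc 0 T
      (fun s => ∫ x in (0 : ℝ)..1, extendRect hT w s x * deriv (deriv φ) x)
      (measurableSet_Iic (a := t))
    have h3 : Iic t ∩ Icc 0 T = Icc 0 t := by
      ext s
      simp only [mem_inter_iff, mem_Iic, mem_Icc]
      constructor
      · rintro ⟨h1, h2, -⟩; exact ⟨h2, h1⟩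
      · rintro ⟨h1, h2⟩; exact ⟨h2, h1, h2.trans ht.2⟩
    rw [h3, integral_Icc_eq_integral_Ioc, ← intervalIntegral.integral_of_le ht.1] at h2
    exact h2

theorem measure_noncontact (hT : 0 ≤ T) (h : SolvesObstacleProblem T z w η) :
    η {p | extendRect hT z p.2 p.1 < extendRect hT w p.2 p.1} = 0 := by
  have h1 := h.complementarity ⟨T, hT, le_rfl⟩
  have huniv : {p : Ioo (0 : ℝ) 1 × Icc (0 : ℝ) T | p.2 ≤ ⟨T, hT, le_rfl⟩} = univ :=
    eq_univ_of_forall fun p => p.2.2.2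
  rw [huniv, Measure.restrict_univ, lintegral_eq_zero_iff] at h1
  · refine measure_mono_null ?_ (ae_iff.1 h1)
    intro p hp
    have e : ∀ u : Icc (0 : ℝ) T → Icc (0 : ℝ) 1 → ℝ,
        extendRect hT u p.2 p.1 = u p.2 ⟨p.1, Ioo_subset_Icc_self p.1.2⟩ := fun u =>
      extendRect_coe hT u p.2 ⟨p.1, Ioo_subset_Icc_self p.1.2⟩
    change extendRect hT z p.2 p.1 < extendRect hT w p.2 p.1 at hp
    rw [e, e] at hp
    change ¬ _ = _
    simpa using hp
  · have hc : Continuous fun p : Ioo (0 : ℝ) 1 × Icc (0 : ℝ) T =>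
        (p.2, (⟨p.1, Ioo_subset_Icc_self p.1.2⟩ : Icc (0 : ℝ) 1)) := by fun_prop
    exact ((h.continuous.comp hc).sub (h.obstacle_continuous.comp hc)).measurable.ennreal_ofReal

theorem zero (T : ℝ) : SolvesObstacleProblem T (fun _ _ => 0) (fun _ _ => 0) 0 where
  obstacle_continuous := continuous_const
  obstacle_boundary := by simp
  obstacle_initial := by simp
  continuous := continuous_const
  boundary := by simp
  initial := by simp
  above_obstacle := by simp
  integrable := by simp
  weak_equation := by simp
  complementarity := by simp

/-- Where `w₁ > w₂ + c x` the solution `w₁` is off its obstacle, so the maximum principle applies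
with the stationary solution `c x`. -/
theorem le_add_of_obstacle_le (hT : 0 ≤ T) (h₁ : SolvesObstacleProblem T z₁ w₁ η₁)
    (h₂ : SolvesObstacleProblem T z₂ w₂ η₂) {c : ℝ} (hc : 0 ≤ c)
    (hz : ∀ t (x : Icc (0 : ℝ) 1), z₁ t x ≤ z₂ t x + c * x) (t : Icc (0 : ℝ) T)
    (x : Icc (0 : ℝ) 1) : w₁ t x ≤ w₂ t x + c * x := by
  have hcoe : ∀ (u : Icc (0 : ℝ) T → Icc (0 : ℝ) 1 → ℝ) {t x : ℝ} (ht : t ∈ Icc 0 T)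
      (hx : x ∈ Icc (0 : ℝ) 1), extendRect hT u t x = u ⟨t, ht⟩ ⟨x, hx⟩ := fun u t x ht hx =>
    extendRect_coe hT u ⟨t, ht⟩ ⟨x, hx⟩
  have h0 : (0 : ℝ) ∈ Icc (0 : ℝ) 1 := ⟨le_rfl, zero_le_one⟩
  have h1 : (1 : ℝ) ∈ Icc (0 : ℝ) 1 := ⟨zero_le_one, le_rfl⟩
  have := (h₁.weakHeat hT).max_principle (h₂.weakHeat hT) le_rfl le_rfl le_rfl
    (IsHeatSuper.linear 0 T 1 c) ?_ ?_ ?_ ?_ t t.2 x x.2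
  · rw [extendRect_coe, extendRect_coe] at this
    linarith
  · intro x hx
    have ht : (0 : ℝ) ∈ Icc 0 T := ⟨le_rfl, hT⟩
    rw [hcoe _ ht hx, hcoe _ ht hx, h₁.initial _ rfl, h₂.initial _ rfl, sub_zero]
    exact mul_nonneg hc hx.1
  · intro t ht
    rw [hcoe _ ht h0, hcoe _ ht h0]
    have e₁ := (h₁.boundary ⟨t, ht⟩).1
    have e₂ := (h₂.boundary ⟨t, ht⟩).1
    change w₁ ⟨t, ht⟩ 0 - w₂ ⟨t, ht⟩ 0 ≤ _
    rw [e₁, e₂]; simp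
  · intro t ht
    rw [hcoe _ ht h1, hcoe _ ht h1]
    have e₁ := (h₁.boundary ⟨t, ht⟩).2
    have e₂ := (h₂.boundary ⟨t, ht⟩).2
    change w₁ ⟨t, ht⟩ 1 - w₂ ⟨t, ht⟩ 1 ≤ _
    rw [e₁, e₂]; simpa using hc
  · refine measure_mono_null ?_ (h₁.measure_noncontact hT)
    rintro p ⟨hp1, -, hp3⟩
    have hx := Ioo_subset_Icc_self p.1.2
    change extendRect hT z₁ p.2 p.1 < extendRect hT w₁ p.2 p.1
    rw [hcoe _ hp1 hx, hcoe _ hp1 hx] at *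
    have e1 := hz ⟨p.2, hp1⟩ ⟨p.1, hx⟩
    have e2 := h₂.above_obstacle ⟨p.2, hp1⟩ ⟨p.1, hx⟩
    dsimp only at e1
    linarith

theorem abs_sub_le (hT : 0 ≤ T) (h₁ : SolvesObstacleProblem T z₁ w₁ η₁)
    (h₂ : SolvesObstacleProblem T z₂ w₂ η₂) {c : ℝ} (hc : 0 ≤ c)
    (hz : ∀ t (x : Icc (0 : ℝ) 1), |z₁ t x - z₂ t x| ≤ c * x) (t : Icc (0 : ℝ) T)
    (x : Icc (0 : ℝ) 1) : |w₁ t x - w₂ t x| ≤ c * x := by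
  have e1 := h₁.le_add_of_obstacle_le hT h₂ hc
    (fun t x => by linarith [(abs_le.1 (hz t x)).2]) t x
  have e2 := h₂.le_add_of_obstacle_le hT h₁ hc
    (fun t x => by linarith [(abs_le.1 (hz t x)).1]) t x
  rw [abs_le]
  constructor <;> linarith

end SolvesObstacleProblem

namespace ScrH

theorem apply_zero (f : ScrH) : f 0 = 0 := f.toMap_mem.1

theorem abs_apply_le (f : ScrH) (x : Icc (0 : ℝ) 1) : |f x| ≤ ‖f‖ * x := by
  rcases x.2.1.eq_or_lt with hx | hx
  · have : x = 0 := Subtype.ext hx.symm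
    rw [this, f.apply_zero]; simp
  · have h := f.le_norm ⟨x, hx, x.2.2⟩
    rw [abs_div, abs_of_pos (show (0 : ℝ) < ((⟨x, hx, x.2.2⟩ : Ioc (0 : ℝ) 1) : ℝ) from hx),
      div_le_iff₀ hx] at h
    exact h

theorem norm_le {f : ScrH} {c : ℝ} (h : ∀ x : Icc (0 : ℝ) 1, |f x| ≤ c * x) : ‖f‖ ≤ c := by
  rw [norm_def]
  refine ciSup_le fun x => ?_
  rw [abs_div, abs_of_pos x.2.1, div_le_iff₀ x.2.1]
  exact h (incl x)

theorem sub_apply (f g : ScrH) (x : Icc (0 : ℝ) 1) : (f - g) x = f x - g x := by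
  change toMap (f - g) x = _
  rw [map_sub]; rfl

/-- The existence of `f'(0)`, as an estimate. -/
theorem exists_slope (f : ScrH) : ∃ a : ℝ, ∀ ε > 0, ∃ δ > 0, ∀ x : Icc (0 : ℝ) 1, (x : ℝ) < δ →
    |f x - a * x| ≤ ε * x := by
  obtain ⟨h0, -, hd⟩ := f.toMap_mem
  have hz : IccExtend (zero_le_one' ℝ) (toMap f) 0 = 0 := by
    rw [IccExtend_of_mem _ _ (left_mem_Icc.2 zero_le_one)]; exact h0
  refine ⟨derivWithin (IccExtend (zero_le_one' ℝ) (toMap f)) (Icc 0 1) 0, fun ε hε => ?_⟩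
  have h := hd.hasDerivWithinAt.isLittleO.bound hε
  rw [eventually_nhdsWithin_iff, Metric.eventually_nhds_iff] at h
  obtain ⟨δ, hδ, h⟩ := h
  refine ⟨δ, hδ, fun x hx => ?_⟩
  have h1 := h (y := (x : ℝ)) (by simpa [abs_of_nonneg x.2.1] using hx) x.2
  rw [hz, IccExtend_of_mem _ _ x.2] at h1
  simpa [abs_of_nonneg x.2.1, mul_comm] using h1

/-- A continuous `f` vanishing at both ends is in `𝓗` if `f(x) / x` is Cauchy as `x → 0`. -/
theorem mem_of_approx_slope {f : C(Icc (0 : ℝ) 1, ℝ)} (h0 : f 0 = 0) (h1 : f 1 = 0)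
    (h : ∀ ε > 0, ∃ L : ℝ, ∃ δ > 0, ∀ x : Icc (0 : ℝ) 1, (x : ℝ) < δ → |f x - L * x| ≤ ε * x) :
    f ∈ hSubmodule := by
  refine ⟨h0, h1, ?_⟩
  have hz : IccExtend (zero_le_one' ℝ) f 0 = 0 := by
    rw [IccExtend_of_mem _ _ (left_mem_Icc.2 zero_le_one)]; exact h0
  have hset : Icc (0 : ℝ) 1 \ {0} = Ioc 0 1 := Icc_sdiff_left
  have hc : Cauchy (map (slope (IccExtend (zero_le_one' ℝ) f) 0) (𝓝[Icc 0 1 \ {0}] 0)) := by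
    rw [hset]
    have : (𝓝[Ioc (0 : ℝ) 1] 0).NeBot := by
      rw [nhdsWithin_Ioc_eq_nhdsGT zero_lt_one]; infer_instance
    rw [Metric.cauchy_iff]
    refine ⟨inferInstance, fun ε hε => ?_⟩
    obtain ⟨L, δ, hδ, hL⟩ := h (ε / 3) (by positivity)
    refine ⟨Metric.closedBall L (ε / 3), ?_, fun x hx y hy => ?_⟩
    · rw [mem_map]
      filter_upwards [self_mem_nhdsWithin, mem_nhdsWithin_of_mem_nhds (Iio_mem_nhds hδ)]
        with x hx hxδ
      have h2 := hL ⟨x, Ioc_subset_Icc_self hx⟩ hxδ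
      have hx0 : 0 < x := hx.1
      rw [mem_preimage, Metric.mem_closedBall, Real.dist_eq]
      rw [slope_def_field, hz, sub_zero, sub_zero, IccExtend_of_mem _ _ (Ioc_subset_Icc_self hx),
        div_sub' hx0.ne', abs_div, abs_of_pos hx0, div_le_iff₀ hx0, mul_comm x]
      exact h2
    · have := dist_triangle_right x y L
      rw [Metric.mem_closedBall] at hx hy
      linarith
  obtain ⟨d, hd⟩ := CompleteSpace.complete hc
  exact (hasDerivWithinAt_iff_tendsto_slope.2 hd).differentiableWithinAt

end ScrH

/-- The quotient `w(t,x) / x` is nearly constant near `(t₀, 0)`. -/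
theorem SolvesObstacleProblem.exists_slope {T : ℝ} (hT : 0 ≤ T) {z : C(Icc (0 : ℝ) T, ScrH)}
    {w : Icc (0 : ℝ) T → Icc (0 : ℝ) 1 → ℝ} {η : Measure (Ioo (0 : ℝ) 1 × Icc (0 : ℝ) T)}
    (h : SolvesObstacleProblem T (fun t x => z t x) w η) (t₀ : Icc (0 : ℝ) T) {ε : ℝ}
    (hε : 0 < ε) : ∃ L, ∃ δ > 0, ∀ t : Icc (0 : ℝ) T, |(t : ℝ) - t₀| < δ →
      ∀ x : Icc (0 : ℝ) 1, (x : ℝ) < δ → |w t x - L * x| ≤ ε * x := by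
  have hC : ∀ t ∈ Icc 0 T, ∀ x ∈ Icc (0 : ℝ) 1, |extendRect hT w t x| ≤ ‖z‖ * x := by
    intro t ht x hx
    rw [show extendRect hT w t x = w ⟨t, ht⟩ ⟨x, hx⟩ from extendRect_coe hT w ⟨t, ht⟩ ⟨x, hx⟩]
    have := h.abs_sub_le hT (SolvesObstacleProblem.zero T) (norm_nonneg z) (fun t x => by
      rw [sub_zero]
      exact ((z t).abs_apply_le x).trans
        (mul_le_mul_of_nonneg_right (z.norm_coe_le_norm t) x.2.1)) ⟨t, ht⟩ ⟨x, hx⟩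
    simpa using this
  have hzw : ∀ t ∈ Icc 0 T, ∀ x ∈ Icc (0 : ℝ) 1,
      extendRect hT (fun t x => z t x) t x ≤ extendRect hT w t x := fun t _ x _ =>
    h.above_obstacle _ _
  have hη := h.measure_noncontact hT
  obtain ⟨a, ha⟩ := (z t₀).exists_slope
  obtain ⟨δ₁, hδ₁, ha⟩ := ha (ε / 6 / 2) (by positivity)
  obtain ⟨δ₂, hδ₂, hz⟩ := Metric.continuousAt_iff.1 (z.continuous.continuousAt (x := t₀))
    (ε / 6 / 2) (by positivity)
  have hz' : ∀ t ∈ Icc 0 T, |t - t₀| < min δ₁ δ₂ → ∀ x ∈ Icc (0 : ℝ) 1, x < min δ₁ δ₂ →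
      |extendRect hT (fun t x => z t x) t x - a * x| ≤ ε / 6 * x := by
    intro t ht htδ x hx hxδ
    rw [show extendRect hT (fun t x => z t x) t x = z ⟨t, ht⟩ ⟨x, hx⟩ from
      extendRect_coe hT (fun t x => z t x) ⟨t, ht⟩ ⟨x, hx⟩]
    have h1 := ha ⟨x, hx⟩ (hxδ.trans_le (min_le_left _ _))
    have h2 : dist (z ⟨t, ht⟩) (z t₀) < ε / 6 / 2 := hz (htδ.trans_le (min_le_right _ _))
    rw [dist_eq_norm] at h2
    have h3 := (z ⟨t, ht⟩ - z t₀).abs_apply_le ⟨x, hx⟩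
    rw [ScrH.sub_apply] at h3
    have h4 := h3.trans (mul_le_mul_of_nonneg_right h2.le hx.1)
    dsimp only at h1
    rw [abs_le] at *
    constructor <;> linarith [h1.1, h1.2, h4.1, h4.2]
  have hcoe : ∀ (t : Icc (0 : ℝ) T) (x : Icc (0 : ℝ) 1), extendRect hT w t x = w t x :=
    extendRect_coe hT w
  rcases t₀.2.1.eq_or_lt with ht₀ | ht₀
  · obtain ⟨δ, hδ, H⟩ := (h.weakHeat hT).exists_slope_initial (ε := ε / 6) hC hzw hη
      (fun x hx => h.initial _ (by simp [projIcc]) _)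
      hT (by positivity) (lt_min hδ₁ hδ₂) (fun t ht htδ => hz' t ht (by
        rwa [← ht₀, sub_zero, abs_of_nonneg ht.1]))
    refine ⟨0, δ, hδ, fun t ht x hx => ?_⟩
    rw [← ht₀, sub_zero, abs_of_nonneg t.2.1] at ht
    have := H t t.2 ht x x.2 hx
    rw [hcoe] at this
    convert this using 1
    · simp
    · ring
  · obtain ⟨L, δ, hδ, H⟩ := (h.weakHeat hT).exists_slope_pos (ε := ε / 6) hC hzw hη ht₀ t₀.2.2
      (by positivity) (lt_min hδ₁ hδ₂) hz'
    refine ⟨L, δ, hδ, fun t ht x hx => ?_⟩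
    have := H t t.2 ht x x.2 hx
    rw [hcoe] at this
    convert this using 1
    ring

theorem SolvesObstacleProblem.exists_continuousMap {T : ℝ} (hT : 0 ≤ T)
    {z : C(Icc (0 : ℝ) T, ScrH)} {w : Icc (0 : ℝ) T → Icc (0 : ℝ) 1 → ℝ}
    {η : Measure (Ioo (0 : ℝ) 1 × Icc (0 : ℝ) T)}
    (h : SolvesObstacleProblem T (fun t x => z t x) w η) :
    ∃ W : C(Icc (0 : ℝ) T, ScrH), ∀ t x, W t x = w t x := by
  have hmem : ∀ t, (⟨w t, h.continuous.uncurry_left t⟩ : C(Icc (0 : ℝ) 1, ℝ)) ∈ hSubmodule := by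
    intro t
    refine ScrH.mem_of_approx_slope (h.boundary t).1 (h.boundary t).2 fun ε hε => ?_
    obtain ⟨L, δ, hδ, H⟩ := h.exists_slope hT t hε
    exact ⟨L, δ, hδ, H t (by simpa using hδ)⟩
  let W : Icc (0 : ℝ) T → ScrH := fun t => (⟨_, hmem t⟩ : hSubmodule)
  have hW : ∀ t x, W t x = w t x := fun _ _ => rfl
  refine ⟨⟨W, continuous_iff_continuousAt.2 fun t₀ => ?_⟩, hW⟩
  rw [Metric.continuousAt_iff]
  intro ε hε
  -- For `x < δ` the norm difference is controlled by the common slope, for `x ≥ δ` by uniform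
  -- continuity.
  obtain ⟨L, δ, hδ, H⟩ := h.exists_slope hT t₀ (show 0 < ε / 4 by positivity)
  obtain ⟨δ', hδ', H'⟩ := Metric.uniformContinuous_iff.1
    (CompactSpace.uniformContinuous_of_continuous h.continuous) (ε / 2 * δ) (by positivity)
  refine ⟨min δ δ', lt_min hδ hδ', fun t ht => ?_⟩
  rw [dist_eq_norm]
  refine lt_of_le_of_lt (ScrH.norm_le (c := ε / 2) fun x => ?_) (by linarith)
  rw [ScrH.sub_apply, hW, hW]
  rcases lt_or_ge (x : ℝ) δ with hx | hx
  · have h1 := abs_le.1 (H t (ht.trans_le (min_le_left _ _)) x hx)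
    have h2 := abs_le.1 (H t₀ (by simpa using hδ) x hx)
    rw [abs_le]
    constructor <;> linarith [h1.1, h1.2, h2.1, h2.2]
  · have h1 : dist (Function.uncurry w (t, x)) (Function.uncurry w (t₀, x)) < ε / 2 * δ := by
      refine H' (max_lt (ht.trans_le (min_le_right _ _)) ?_)
      simpa using hδ'
    have h2 : ε / 2 * δ ≤ ε / 2 * x := mul_le_mul_of_nonneg_left hx (by positivity)
    exact (le_of_lt h1).trans h2

end

/-- Elements `z` of `C([0,T]; 𝓗)` are Mathlib's continuous maps from `[0,T]` into the normed space
`𝓗`, and `‖z‖ = sup_{t ∈ [0,T]} ‖z(t)‖_𝓗` is the norm of this space. -/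
theorem theorem3p1 (T : ℝ) (hT : 0 < T) (z₁ z₂ : C(Icc (0 : ℝ) T, ScrH))
    (w₁ w₂ : Icc (0 : ℝ) T → Icc (0 : ℝ) 1 → ℝ)
    (η₁ η₂ : Measure (Ioo (0 : ℝ) 1 × Icc (0 : ℝ) T))
    (h₁ : SolvesObstacleProblem T (fun t x => z₁ t x) w₁ η₁)
    (h₂ : SolvesObstacleProblem T (fun t x => z₂ t x) w₂ η₂) :
    ∃ W₁ W₂ : C(Icc (0 : ℝ) T, ScrH),
      (∀ t x, W₁ t x = w₁ t x) ∧ (∀ t x, W₂ t x = w₂ t x) ∧ ‖W₁ - W₂‖ ≤ ‖z₁ - z₂‖ := by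
  obtain ⟨W₁, hW₁⟩ := h₁.exists_continuousMap hT.le
  obtain ⟨W₂, hW₂⟩ := h₂.exists_continuousMap hT.le
  refine ⟨W₁, W₂, hW₁, hW₂, ?_⟩
  refine (ContinuousMap.norm_le _ (norm_nonneg _)).2 fun t => ScrH.norm_le fun x => ?_
  rw [ContinuousMap.sub_apply, ScrH.sub_apply, hW₁, hW₂]
  refine h₁.abs_sub_le hT.le h₂ (norm_nonneg _) (fun t x => ?_) t x
  rw [← ScrH.sub_apply, ← ContinuousMap.sub_apply]
  exact ((z₁ - z₂) t).abs_apply_le x |>.trans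
    (mul_le_mul_of_nonneg_right ((z₁ - z₂).norm_coe_le_norm t) x.2.1)
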